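/- Let $\mathbf{N}=\{1,2,\ldots\}$. For a finite group $G$ let $\zeta^{G}(s)=\sum_{\chi\in\mathrm{Irr}\,G}\chi(1)^{-s}$, the sum being over the isomorphism classes of irreducible complex representations of $G$ and $\chi(1)$ denoting the dimension; let $S_n$ be the symmetric group on $n$ letters. Let $s\in\mathbf{N}$ and $M\in\mathbf{N}$. Then: (1) there is a polynomial $P_{s,M}\in\mathbf{Z}[t]$ of degree $<M$ with constant coefficient $1$ such that, as $n\to\infty$, $$\zeta^{S_n}(s)=2\cdot P_{s,M}(n^{-1})+O(n^{-M});$$ (2) there is a polynomial $Q_{s,M}\in\mathbf{Z}[t]$ of degree $<M$ with constant coefficient $1$ such that, as $n\to\infty$, $$\frac{1}{\zeta^{S_n}(s)}=\frac12\,Q_{s,M}(n^{-1})+O(n^{-M}).$$ The implied constants may depend on $s$ and $M$. -/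

import Mathlib

open Polynomial Filter Asymptotics

/-- An irreducible (finite-dimensional) complex representation of `G`, realised on a
coordinate space `ℂ ^ dim`. Up to isomorphism every finite-dimensional irreducible complex
representation is of this form. -/
structure IrrepData (G : Type) [Group G] where
  dim : ℕ
  rep : Representation ℂ G (Fin dim → ℂ)
  irreducible : rep.IsIrreducible

/-- Isomorphism of representations, as an equivalence relation on the irreducible ones. -/
instance IrrepData.isoSetoid (G : Type) [Group G] : Setoid (IrrepData G) where
  r V W := Nonempty (V.rep.Equiv W.rep)
  iseqv :=
    { refl := fun V => ⟨Representation.Equiv.refl V.rep⟩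
      symm := fun ⟨e⟩ => ⟨e.symm⟩
      trans := fun ⟨e⟩ ⟨f⟩ => ⟨e.trans f⟩ }

/-- `Irr G`: the isomorphism classes of irreducible complex representations of `G`. -/
def Irr (G : Type) [Group G] : Type := Quotient (IrrepData.isoSetoid G)

/-- The dimension `χ(1)` of an isomorphism class of irreducible representations. -/
def Irr.dim {G : Type} [Group G] : Irr G → ℕ :=
  Quotient.lift IrrepData.dim (by
    rintro V W ⟨e⟩
    simpa using e.toLinearEquiv.finrank_eq)

/-- A finite group has finitely many irreducible complex representations up to isomorphism,
so that the sum in `wittenZeta` is a genuine finite sum. -/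
theorem Irr.finite (G : Type) [Group G] [Finite G] : Finite (Irr G) := by
  classical
  have := Fintype.ofFinite G
  have hcard : (Nat.card G : ℂ) ≠ 0 := Nat.cast_ne_zero.mpr Nat.card_pos.ne'
  let _ : Invertible (Nat.card G : ℂ) := invertibleOfNonzero hcard
  let chi : Irr G → (G → ℂ) := fun x => x.out.rep.character
  have key : ∀ x y : Irr G,
      (∑ g : G, chi x g * chi y g⁻¹) = if x = y then (Nat.card G : ℂ) else 0 := by
    intro x y
    have := x.out.irreducible
    have := y.out.irreducible
    have h := Representation.char_orthonormal x.out.rep y.out.rep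
    have hiff : Nonempty (y.out.rep.Equiv x.out.rep) ↔ x = y := by
      rw [eq_comm]
      exact Quotient.out_equiv_out (s := IrrepData.isoSetoid G) (x := y) (y := x)
    rw [inv_mul_eq_iff_eq_mul₀ hcard] at h
    refine h.trans ?_
    simp only [hiff]
    split_ifs <;> simp
  have li : LinearIndependent ℂ chi := by
    rw [linearIndependent_iff']
    intro s c hc x hx
    have h1 : ∑ g : G, (∑ y ∈ s, c y • chi y) g * chi x g⁻¹ = 0 := by
      rw [hc]; simp
    have h2 : ∑ g : G, (∑ y ∈ s, c y • chi y) g * chi x g⁻¹ = c x * (Nat.card G : ℂ) := by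
      simp only [Finset.sum_apply, Pi.smul_apply, smul_eq_mul, Finset.sum_mul, mul_assoc]
      rw [Finset.sum_comm]
      simp only [← Finset.mul_sum, key]
      simp [hx]
    rw [h2] at h1
    simpa using h1
  exact li.finite

/-- The Witten zeta function `ζ^G(s) = ∑_{χ ∈ Irr G} χ(1)^{-s}` of a finite group `G`. -/
noncomputable def wittenZeta (G : Type) [Group G] [Finite G] (s : ℝ) : ℝ :=
  ∑ᶠ χ : Irr G, (χ.dim : ℝ) ^ (-s)

/-! Sort the irreducible representations of S_n by depth b = n − λ₁, the number of boxes below the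
first row. When 2b ≤ n, those of depth b correspond to the partitions of b, and the degree formula
gives the dimension as ∏ (n − L_j) / H, with L the beta-set of the small partition and H its hook
product. The dimension is thus a polynomial in n of degree b. Its power −s has an integral expansion
in 1/n, since H is an integer and (n − l)⁻¹ is a geometric series; depth 0 contributes exactly 1,
and depth b > 0 has no constant term. Tensoring with the sign yields a disjoint second copy of the
representations of small depth, whence the factor 2.

The remainder must be O(n^{-M}), and since dimensions are at least 1 it suffices to bound it for s =
1. Depths from M up to n/16, and their twists, are controlled by a geometric series
(`sum_depthTerm_le`). For everything else, `exists_hasFixed_or_twist` shows that depth is at most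
logarithmic in the dimension, up to twist, so the dimension is exponentially large; the number of
representations is at most the partition number, which is subexponential (`exists_sum_large_le`).

Depth is defined without partitions, as the least number of points whose pointwise stabiliser has a
nonzero invariant vector. Characters come from Frobenius' formula: `frob` is a coefficient of
Vandermonde times power sums. It is a virtual character, has norm one, and has positive degree,
hence is irreducible. The two descriptions meet in `isDepth_iff`, because pairing with permutation
characters reads off coefficients of Schur polynomials, whose largest exponent in one variable is
λ₁.

For the reciprocal, an integral polynomial with constant coefficient 1 is invertible modulo X^M over
ℤ. -/

namespace SymmetricZeta

open Finset

/-! ### Colourings and weighted orbit counting. -/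

/-- The content of a colouring: how often each colour is used. -/
noncomputable def content {κ : Type*} {n : ℕ} (f : Fin n → κ) : κ →₀ ℕ :=
  ∑ i, Finsupp.single (f i) 1

theorem content_apply {κ : Type*} [DecidableEq κ] {n : ℕ} (f : Fin n → κ) (j : κ) :
    content f j = #{i | f i = j} := by
  simp only [content, Finsupp.finsetSum_apply, Finsupp.single_apply, Finset.card_filter]

theorem content_comp_perm {κ : Type*} {n : ℕ} (f : Fin n → κ) (g : Equiv.Perm (Fin n)) :
    content (f ∘ g) = content f :=
  Equiv.sum_comp g fun i => Finsupp.single (f i) 1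

theorem sum_content {κ : Type*} [Fintype κ] {n : ℕ} (f : Fin n → κ) :
    ∑ j, content f j = n := by
  classical
  simp only [content_apply]
  rw [← Finset.card_eq_sum_card_fiberwise (f := f) (t := univ) (by simp)]
  simp

theorem exists_content_eq {κ : Type*} [Fintype κ] {n : ℕ} (c : κ →₀ ℕ) (hc : ∑ j, c j = n) :
    ∃ f : Fin n → κ, content f = c := by
  classical
  have e : Fin n ≃ Σ j, Fin (c j) := Fintype.equivOfCardEq (by simp [hc])
  refine ⟨fun i => (e i).1, ?_⟩
  ext j
  rw [content_apply, ← Fintype.card_subtype]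
  have : {i // (e i).1 = j} ≃ Fin (c j) :=
    (e.subtypeEquiv (q := fun x => x.1 = j) (fun _ => Iff.rfl)).trans (Equiv.sigmaSubtype j)
  rw [Fintype.card_congr this, Fintype.card_fin]

theorem exists_perm_of_content_eq {κ : Type*} {n : ℕ} {f f' : Fin n → κ}
    (h : content f = content f') : ∃ g : Equiv.Perm (Fin n), f ∘ g = f' := by
  classical
  have key : ∀ j, Nonempty ({i // f' i = j} ≃ {i // f i = j}) := fun j => by
    refine ⟨Fintype.equivOfCardEq ?_⟩
    have := DFunLike.congr_fun h j
    rw [content_apply, content_apply] at this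
    rw [Fintype.card_subtype, Fintype.card_subtype, this]
  let e := fun j => (key j).some
  refine ⟨(Equiv.sigmaFiberEquiv f').symm.trans
    ((Equiv.sigmaCongrRight e).trans (Equiv.sigmaFiberEquiv f)), ?_⟩
  ext i
  exact (e (f' i) ⟨i, rfl⟩).2

/-- Weighted orbit counting for colourings. -/
theorem sum_card_fixed_content {κ : Type*} [Fintype κ] [DecidableEq κ] {n : ℕ} (c : κ →₀ ℕ)
    (hc : ∑ j, c j = n) :
    ∑ g : Equiv.Perm (Fin n), #{f : Fin n → κ | f ∘ g = f ∧ content f = c} = n.factorial := by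
  obtain ⟨f₀, hf₀⟩ := exists_content_eq c hc
  have h1 : ∑ g : Equiv.Perm (Fin n), #{f : Fin n → κ | f ∘ g = f ∧ content f = c} =
      ∑ f : Fin n → κ with content f = c, #{g : Equiv.Perm (Fin n) | f ∘ g = f} := by
    simp only [Finset.card_filter, Finset.sum_filter]
    rw [Finset.sum_comm]
    refine Finset.sum_congr rfl fun f _ => ?_
    by_cases hf : content f = c <;> simp [hf]
  -- The stabiliser of `f` is in bijection with the set carrying the base colouring `f₀` to `f`. As
  -- `f` varies over its content class these sets partition the whole group.
  have h2 : ∀ f ∈ ({f : Fin n → κ | content f = c} : Finset _),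
      #{g : Equiv.Perm (Fin n) | f ∘ g = f} = #{g : Equiv.Perm (Fin n) | f₀ ∘ g = f} := by
    intro f hf
    obtain ⟨σ, hσ⟩ := exists_perm_of_content_eq (hf₀.trans (Finset.mem_filter.1 hf).2.symm)
    refine Finset.card_bij (fun g _ => σ * g) ?_ ?_ ?_
    · intro g hg
      simp only [mem_filter, mem_univ, true_and] at hg ⊢
      rw [Equiv.Perm.coe_mul, ← Function.comp_assoc, hσ, hg]
    · intro a _ b _ hab
      exact mul_left_cancel hab
    · intro τ hτ
      simp only [mem_filter, mem_univ, true_and] at hτ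
      refine ⟨σ⁻¹ * τ, ?_, by simp⟩
      simp only [mem_filter, mem_univ, true_and]
      rw [Equiv.Perm.coe_mul, ← Function.comp_assoc]
      have : f ∘ ⇑σ⁻¹ = f₀ := by
        rw [← hσ, Function.comp_assoc, ← Equiv.Perm.coe_mul]; simp
      rw [this, hτ]
  rw [h1, Finset.sum_congr rfl h2]
  rw [← Finset.card_eq_sum_card_fiberwise (f := fun g : Equiv.Perm (Fin n) => f₀ ∘ g)
    (s := univ) (t := {f : Fin n → κ | content f = c})]
  · simp [Fintype.card_perm]
  · intro g _
    simp [content_comp_perm, hf₀]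

/-! ### Permutation characters and complete homogeneous polynomials. -/

/-- The generating polynomial of the colourings fixed by a permutation, by content. -/
noncomputable def fixedPoly (k : ℕ) {n : ℕ} (g : Equiv.Perm (Fin n)) : MvPolynomial (Fin k) ℤ :=
  ∑ f : Fin n → Fin k with f ∘ g = f, MvPolynomial.monomial (content f) 1

/-- The permutation character of the symmetric group on colourings of a given content. -/
noncomputable def permChar {k n : ℕ} (α : Fin k →₀ ℕ) (g : Equiv.Perm (Fin n)) : ℤ :=
  #{f : Fin n → Fin k | f ∘ g = f ∧ content f = α}

theorem coeff_fixedPoly {k n : ℕ} (α : Fin k →₀ ℕ) (g : Equiv.Perm (Fin n)) :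
    (fixedPoly k g).coeff α = permChar α g := by
  simp only [fixedPoly, MvPolynomial.coeff_sum, MvPolynomial.coeff_monomial, permChar,
    Finset.sum_boole, Finset.filter_filter]

/-- The complete homogeneous symmetric polynomial. -/
noncomputable def hPoly (k m : ℕ) : MvPolynomial (Fin k) ℤ :=
  ∑ c ∈ finsuppAntidiag (univ : Finset (Fin k)) m, MvPolynomial.monomial c 1

theorem mapDomain_fst_apply {ι κ : Type*} [Fintype ι] [Fintype κ] (c : ι × κ →₀ ℕ) (j : ι) :
    c.mapDomain Prod.fst j = ∑ i, c (j, i) := by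
  classical
  rw [Finsupp.mapDomain, Finsupp.sum_fintype _ _ (by simp), Finsupp.finsetSum_apply,
    Fintype.sum_prod_type, Finset.sum_eq_single j]
  · simp
  · intro b _ hb
    simp [hb]
  · simp

theorem mapDomain_snd_apply {ι κ : Type*} [Fintype ι] [Fintype κ] (c : ι × κ →₀ ℕ) (i : κ) :
    c.mapDomain Prod.snd i = ∑ j, c (j, i) := by
  classical
  rw [Finsupp.mapDomain, Finsupp.sum_fintype _ _ (by simp), Finsupp.finsetSum_apply,
    Fintype.sum_prod_type]
  refine Finset.sum_congr rfl fun j _ => ?_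
  rw [Finset.sum_eq_single i]
  · simp
  · intro b _ hb
    simp [hb]
  · simp

/-- Choosing a monomial from each factor amounts to a matrix of natural numbers with row sums `β`;
its column sums are the exponents of the product. -/
theorem prod_hPoly {k n : ℕ} (β : Fin k →₀ ℕ) (hβ : ∑ j, β j = n) :
    ∏ j, hPoly k (β j) =
      ∑ c ∈ finsuppAntidiag (univ : Finset (Fin k × Fin k)) n with c.mapDomain Prod.fst = β,
        MvPolynomial.monomial (c.mapDomain Prod.snd) 1 := by
  have h : ∏ j, hPoly k (β j) = ∑ d ∈ Fintype.piFinset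
      fun j => finsuppAntidiag (univ : Finset (Fin k)) (β j),
        MvPolynomial.monomial (∑ j, d j) 1 := by
    simp only [hPoly]
    rw [Finset.prod_univ_sum]
    exact Finset.sum_congr rfl fun d _ => (MvPolynomial.monomial_sum_one _ _).symm
  rw [h]
  symm
  refine Finset.sum_bij' (fun c _ => fun j => Finsupp.equivFunOnFinite.symm fun i => c (j, i))
    (fun d _ => Finsupp.equivFunOnFinite.symm fun p => d p.1 p.2) ?_ ?_ ?_ ?_ ?_
  · intro c hc
    have := (Finset.mem_filter.1 hc).2
    simp [mem_finsuppAntidiag, ← this, mapDomain_fst_apply]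
  · intro d hd
    have hd' : ∀ j, ∑ i, d j i = β j := by
      simpa [mem_finsuppAntidiag] using hd
    rw [Finset.mem_filter]
    refine ⟨?_, ?_⟩
    · simp [mem_finsuppAntidiag, Fintype.sum_prod_type, hd', hβ]
    · ext j
      simp [mapDomain_fst_apply, hd']
  · intro c _
    ext p
    rfl
  · intro d _
    funext j
    ext i
    rfl
  · intro c _
    refine congrArg (fun e => MvPolynomial.monomial e 1) (Finsupp.ext fun i => ?_)
    rw [mapDomain_snd_apply, Finsupp.finsetSum_apply]
    rfl

/-- The Frobenius characteristic of a permutation character is a product of complete homogeneous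
polynomials. Two colourings fixed by g form one fixed colouring by pairs; by orbit counting each
content of pairs occurs n! times in the sum over g, and the contents are the matrices of
`prod_hPoly`. -/
theorem sum_permChar_smul_fixedPoly {k n : ℕ} (β : Fin k →₀ ℕ) (hβ : ∑ j, β j = n) :
    ∑ g : Equiv.Perm (Fin n), permChar β g • fixedPoly k g =
      (n.factorial : ℤ) • ∏ j, hPoly k (β j) := by
  -- colourings by pairs of colours
  let col : (Fin k × Fin k →₀ ℕ) → (Fin k →₀ ℕ) := fun c => c.mapDomain Prod.fst
  let row : (Fin k × Fin k →₀ ℕ) → (Fin k →₀ ℕ) := fun c => c.mapDomain Prod.snd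
  have hcol : ∀ F : Fin n → Fin k × Fin k, col (content F) = content (fun i => (F i).1) :=
    fun F => by simp [col, content, Finsupp.mapDomain_finsetSum]
  have hrow : ∀ F : Fin n → Fin k × Fin k, row (content F) = content (fun i => (F i).2) :=
    fun F => by simp [row, content, Finsupp.mapDomain_finsetSum]
  let w : (Fin k × Fin k →₀ ℕ) → MvPolynomial (Fin k) ℤ := fun c =>
    if col c = β then MvPolynomial.monomial (row c) 1 else 0
  have h1 : ∀ g : Equiv.Perm (Fin n), permChar β g • fixedPoly k g =
      ∑ F : Fin n → Fin k × Fin k with F ∘ g = F, w (content F) := by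
    intro g
    rw [Finset.sum_filter, ← (Equiv.arrowProdEquivProdArrow _ _ _).symm.sum_comp,
      Fintype.sum_prod_type]
    simp only [permChar, fixedPoly, Finset.card_filter, Nat.cast_sum, Finset.sum_smul,
      Finset.sum_filter]
    refine Finset.sum_congr rfl fun f _ => ?_
    rw [Finset.smul_sum]
    refine Finset.sum_congr rfl fun f' _ => ?_
    have e1 : ((Equiv.arrowProdEquivProdArrow (Fin n) (fun _ => Fin k)
        (fun _ => Fin k)).symm (f, f')) = fun i => (f i, f' i) := rfl
    have e2 : ((fun i => (f i, f' i)) ∘ ⇑g = fun i => (f i, f' i)) ↔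
        f ∘ g = f ∧ f' ∘ g = f' := by
      simp only [funext_iff, Function.comp_apply, Prod.mk.injEq, forall_and]
    rw [e1]
    simp only [e2, w, hcol, hrow]
    by_cases a : f ∘ ⇑g = f <;> by_cases b : f' ∘ ⇑g = f' <;> by_cases d : content f = β <;>
      simp [a, b, d]
  have h2 : ∑ g : Equiv.Perm (Fin n), ∑ F : Fin n → Fin k × Fin k with F ∘ g = F, w (content F) =
      ∑ c ∈ finsuppAntidiag (univ : Finset (Fin k × Fin k)) n, (n.factorial : ℤ) • w c := by
    have : ∀ g : Equiv.Perm (Fin n), ∑ F : Fin n → Fin k × Fin k with F ∘ g = F, w (content F) =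
        ∑ c ∈ finsuppAntidiag (univ : Finset (Fin k × Fin k)) n,
          #{F : Fin n → Fin k × Fin k | F ∘ g = F ∧ content F = c} • w c := by
      intro g
      rw [← Finset.sum_fiberwise_of_maps_to (g := content)
        (t := finsuppAntidiag (univ : Finset (Fin k × Fin k)) n)]
      · refine Finset.sum_congr rfl fun c _ => ?_
        rw [Finset.filter_filter, Finset.sum_congr rfl (g := fun _ => w c), Finset.sum_const]
        intro F hF
        rw [(Finset.mem_filter.1 hF).2.2]
      · intro F _
        simp [mem_finsuppAntidiag, sum_content]
    simp only [this]
    rw [Finset.sum_comm]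
    refine Finset.sum_congr rfl fun c hc => ?_
    rw [← Finset.sum_smul, sum_card_fixed_content c (by simpa using (mem_finsuppAntidiag.1 hc).1)]
    simp
  rw [Finset.sum_congr rfl fun g _ => h1 g, h2, ← Finset.smul_sum]
  congr 1
  rw [prod_hPoly β hβ, Finset.sum_filter]

/-! ### Alternants and the Jacobi–Trudi identity. -/

/-- `hPoly k (m - s)`, read as `0` when `m < s`. -/
noncomputable def hShift (k m s : ℕ) : MvPolynomial (Fin k) ℤ :=
  if s ≤ m then hPoly k (m - s) else 0

/-- The alternant with exponents `l`. -/
noncomputable def alternant {k : ℕ} (l : Fin k → ℕ) : MvPolynomial (Fin k) ℤ :=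
  (Matrix.of fun i j => MvPolynomial.X i ^ l j : Matrix (Fin k) (Fin k) (MvPolynomial (Fin k) ℤ)).det

/-- The Jacobi–Trudi determinant (a Schur polynomial for increasing `l`). -/
noncomputable def schur {k : ℕ} (l : Fin k → ℕ) : MvPolynomial (Fin k) ℤ :=
  (Matrix.of fun s j => hShift k (l j) s : Matrix (Fin k) (Fin k) (MvPolynomial (Fin k) ℤ)).det

/-- The Vandermonde determinant. -/
noncomputable def vdm (k : ℕ) : MvPolynomial (Fin k) ℤ := alternant fun j : Fin k => (j : ℕ)

theorem coeff_prod_geometric (k m : ℕ) :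
    PowerSeries.coeff m (∏ j : Fin k, PowerSeries.mk fun r => (MvPolynomial.X j : MvPolynomial (Fin k) ℤ) ^ r) =
      hPoly k m := by
  rw [PowerSeries.coeff_prod, hPoly]
  refine Finset.sum_congr rfl fun c _ => ?_
  simp only [PowerSeries.coeff_mk]
  rw [MvPolynomial.monomial_eq]
  simp [Finsupp.prod_fintype]

/-- Multiply the generating series ∏ 1/(1 − x_j t) of the complete homogeneous polynomials by E(t) =
∏_{j≠i} (1 − x_j t): what remains is 1/(1 − x_i t). Since E has degree below k, comparing
coefficients of t^m involves only k terms, with coefficients independent of m. -/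
theorem exists_pow_eq_sum_hShift (k : ℕ) (i : Fin k) :
    ∃ e : Fin k → MvPolynomial (Fin k) ℤ, ∀ m : ℕ,
      MvPolynomial.X i ^ m = ∑ s : Fin k, e s * hShift k m s := by
  let R := MvPolynomial (Fin k) ℤ
  let E : R[X] := ∏ j ∈ univ.erase i, (1 - Polynomial.C (MvPolynomial.X j) * Polynomial.X)
  have hdeg : E.natDegree < k := by
    refine (Polynomial.natDegree_prod_le _ _).trans_lt ?_
    refine (Finset.sum_le_card_nsmul _ _ 1 fun j _ => ?_).trans_lt ?_
    · compute_degree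
    · have := i.isLt
      simp
      omega
  have hgeom : ∀ j : Fin k, ((1 - Polynomial.C (MvPolynomial.X j) * Polynomial.X : R[X]) : PowerSeries R) *
      PowerSeries.mk (fun r => (MvPolynomial.X j : R) ^ r) = 1 := by
    intro j
    ext1 m
    rw [Polynomial.coe_sub, Polynomial.coe_mul, Polynomial.coe_one, Polynomial.coe_C, Polynomial.coe_X,
      sub_mul, one_mul, mul_assoc, map_sub, PowerSeries.coeff_C_mul]
    cases m with
    | zero => simp
    | succ m => simp [PowerSeries.coeff_succ_X_mul, pow_succ', PowerSeries.coeff_one]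
  have hmul : (E : PowerSeries R) * ∏ j : Fin k, PowerSeries.mk (fun r => (MvPolynomial.X j : R) ^ r) =
      PowerSeries.mk fun r => (MvPolynomial.X i : R) ^ r := by
    rw [← Finset.mul_prod_erase univ _ (Finset.mem_univ i), mul_left_comm]
    have : (E : PowerSeries R) = ∏ j ∈ univ.erase i,
        ((1 - Polynomial.C (MvPolynomial.X j) * Polynomial.X : R[X]) : PowerSeries R) :=
      map_prod (Polynomial.coeToPowerSeries.ringHom (R := R))
        (fun j => 1 - Polynomial.C (MvPolynomial.X j) * Polynomial.X) (univ.erase i)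
    rw [this, ← Finset.prod_mul_distrib, Finset.prod_congr rfl fun j _ => hgeom j]
    simp
  refine ⟨fun s => E.coeff s, fun m => ?_⟩
  have h := congrArg (PowerSeries.coeff m) hmul
  rw [PowerSeries.coeff_mk, PowerSeries.coeff_mul] at h
  rw [← h, Finset.Nat.sum_antidiagonal_eq_sum_range_succ_mk]
  simp only [Polynomial.coeff_coe]
  have h1 : ∑ s : Fin k, E.coeff s * hShift k m s = ∑ s ∈ range k, E.coeff s * hShift k m s :=
    (Fin.sum_univ_eq_sum_range (fun s => E.coeff s * hShift k m s) k)
  rw [h1]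
  have h2 : ∀ N, m.succ ≤ N → k ≤ N → ∑ s ∈ range k, E.coeff s * hShift k m s =
      ∑ s ∈ range N, E.coeff s * hShift k m s := by
    intro N _ hN
    refine Finset.sum_subset (Finset.range_mono hN) fun s _ hs => ?_
    rw [Polynomial.coeff_eq_zero_of_natDegree_lt (by simp at hs; omega), zero_mul]
  rw [h2 (max m.succ k) (le_max_left _ _) (le_max_right _ _)]
  symm
  rw [← Finset.sum_subset (Finset.range_mono (le_max_left m.succ k))]
  · refine Finset.sum_congr rfl fun s hs => ?_
    rw [hShift, if_pos (by simp at hs; omega)]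
    exact congrArg _ (coeff_prod_geometric k (m - s)).symm
  · intro s _ hs
    rw [hShift, if_neg (by simp at hs; omega), mul_zero]

theorem schur_id (k : ℕ) : schur (fun j : Fin k => (j : ℕ)) = 1 := by
  rw [schur, Matrix.det_of_isUpperTriangular]
  · refine Finset.prod_eq_one fun i _ => ?_
    simp [hShift, hPoly]
  · intro i j hij
    have : (j : ℕ) < i := hij
    simp only [Matrix.of_apply, hShift, if_neg this.not_ge]

/-- The previous recurrence factors the alternant matrix through a fixed matrix. The determinant of
that matrix is found from exponents 0, …, k − 1, where the Jacobi–Trudi matrix is unitriangular. -/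
theorem alternant_eq {k : ℕ} (l : Fin k → ℕ) : alternant l = vdm k * schur l := by
  choose e he using exists_pow_eq_sum_hShift k
  have h : ∀ l : Fin k → ℕ, alternant l = (Matrix.of e).det * schur l := by
    intro l
    rw [alternant, schur, ← Matrix.det_mul]
    congr 1
    ext1 i j
    simp [Matrix.mul_apply, he i (l j)]
  rw [h l, vdm, h, schur_id, mul_one]

/-- The exponent vector `j ↦ w j`. -/
noncomputable def permExp {k : ℕ} (w : Equiv.Perm (Fin k)) : Fin k →₀ ℕ :=
  Finsupp.equivFunOnFinite.symm fun i => (w i : ℕ)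

theorem alternant_eq_sum {k : ℕ} (l : Fin k → ℕ) : alternant l =
    ∑ w : Equiv.Perm (Fin k), (Equiv.Perm.sign w : ℤ) •
      MvPolynomial.monomial (Finsupp.equivFunOnFinite.symm fun i => l (w i)) 1 := by
  rw [alternant, ← Matrix.det_transpose, Matrix.det_apply]
  refine Finset.sum_congr rfl fun w _ => ?_
  rw [Units.smul_def]
  congr 1
  rw [MvPolynomial.monomial_eq]
  simp [Finsupp.prod_fintype]

theorem vdm_ne_zero (k : ℕ) : vdm k ≠ 0 := by
  have : vdm k = (Matrix.vandermonde fun i : Fin k => (MvPolynomial.X i : MvPolynomial (Fin k) ℤ)).det := rfl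
  rw [this]
  exact Matrix.det_vandermonde_ne_zero_iff.2 (MvPolynomial.X_injective)

/-! ### Frobenius functions: orthogonality and degree. -/

/-- The Frobenius class function attached to an exponent vector `l`. -/
noncomputable def frob {k n : ℕ} (l : Fin k → ℕ) (g : Equiv.Perm (Fin n)) : ℤ :=
  (vdm k * fixedPoly k g).coeff (Finsupp.equivFunOnFinite.symm l)

/-- Expanding the Vandermonde determinant exhibits an integral combination of permutation
characters. The guard discards negative exponents, which truncated subtraction would hide. -/
theorem frob_eq_sum {k n : ℕ} (l : Fin k → ℕ) (g : Equiv.Perm (Fin n)) :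
    frob l g = ∑ w : Equiv.Perm (Fin k), (Equiv.Perm.sign w : ℤ) *
      if permExp w ≤ Finsupp.equivFunOnFinite.symm l then
        permChar (Finsupp.equivFunOnFinite.symm l - permExp w) g else 0 := by
  rw [frob, vdm, alternant_eq_sum, Finset.sum_mul, MvPolynomial.coeff_sum]
  refine Finset.sum_congr rfl fun w _ => ?_
  rw [smul_mul_assoc, MvPolynomial.coeff_smul, MvPolynomial.coeff_monomial_mul', smul_eq_mul,
    one_mul, coeff_fixedPoly]
  rfl

theorem sum_permExp {k : ℕ} (w : Equiv.Perm (Fin k)) : ∑ i, permExp w i = ∑ i : Fin k, (i : ℕ) :=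
  Equiv.sum_comp w fun i => (i : ℕ)

theorem sum_frob_smul_fixedPoly {k n : ℕ} (l : Fin k → ℕ)
    (hl : ∑ j, l j = n + ∑ j : Fin k, (j : ℕ)) :
    ∑ g : Equiv.Perm (Fin n), frob l g • fixedPoly k g = (n.factorial : ℤ) • schur l := by
  simp only [frob_eq_sum, Finset.sum_smul]
  rw [Finset.sum_comm, schur, Matrix.det_apply, Finset.smul_sum]
  refine Finset.sum_congr rfl fun w _ => ?_
  simp only [mul_smul, ← Finset.smul_sum, Matrix.of_apply, Units.smul_def]
  rw [smul_comm]
  congr 1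
  split_ifs with hw
  · rw [sum_permChar_smul_fixedPoly]
    · congr 1
      refine Finset.prod_congr rfl fun j _ => ?_
      have hj : (w j : ℕ) ≤ l j := hw j
      rw [hShift, if_pos hj]
      rfl
    · have h1 : ∑ j, (Finsupp.equivFunOnFinite.symm l - permExp w) j + ∑ j, permExp w j =
          ∑ j, l j := by
        rw [← Finset.sum_add_distrib]
        exact Finset.sum_congr rfl fun j _ => Nat.sub_add_cancel (hw j)
      rw [sum_permExp, hl] at h1
      omega
  · obtain ⟨j, hj⟩ : ∃ j, ¬ (w j : ℕ) ≤ l j := by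
      by_contra h
      push Not at h
      exact hw fun j => h j
    rw [Finset.prod_eq_zero (Finset.mem_univ j) (by rw [hShift, if_neg hj])]
    simp

theorem coeff_alternant {k : ℕ} {l m : Fin k → ℕ} (hl : StrictMono l) (hm : StrictMono m) :
    (alternant m).coeff (Finsupp.equivFunOnFinite.symm l) = if l = m then 1 else 0 := by
  rw [alternant_eq_sum, MvPolynomial.coeff_sum]
  simp only [MvPolynomial.coeff_smul, MvPolynomial.coeff_monomial, EmbeddingLike.apply_eq_iff_eq]
  have key : ∀ w : Equiv.Perm (Fin k), (fun i => m (w i)) = l ↔ w = 1 ∧ l = m := by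
    intro w
    constructor
    · intro h
      have hlm : l = m := (hl.range_inj hm).1 (by rw [← h]; exact w.surjective.range_comp m)
      exact ⟨Equiv.ext fun i => hm.injective ((congrFun h i).trans (congrFun hlm i)), hlm⟩
    · rintro ⟨rfl, rfl⟩
      rfl
  simp only [key]
  by_cases h : l = m <;> simp [h]

/-- The characteristic of `frob m` is `schur m`; times the Vandermonde determinant it becomes an
alternant, whose only monomial with increasing exponents is `m` itself. -/
theorem sum_frob_mul_frob {k n : ℕ} {l m : Fin k → ℕ} (hl : StrictMono l) (hm : StrictMono m)
    (hsum : ∑ j, m j = n + ∑ j : Fin k, (j : ℕ)) :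
    ∑ g : Equiv.Perm (Fin n), frob l g * frob m g = if l = m then (n.factorial : ℤ) else 0 := by
  have h := congrArg (fun p => (vdm k * p).coeff (Finsupp.equivFunOnFinite.symm l))
    (sum_frob_smul_fixedPoly m hsum)
  simp only [Finset.mul_sum, mul_smul_comm, MvPolynomial.coeff_sum, MvPolynomial.coeff_smul,
    ← alternant_eq, coeff_alternant hl hm] at h
  simpa [frob, mul_comm] using h

theorem permChar_one {k n : ℕ} (α : Fin k →₀ ℕ) (hα : ∑ j, α j = n) :
    permChar α (1 : Equiv.Perm (Fin n)) * ∏ j, ((α j).factorial : ℤ) = n.factorial := by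
  have h1 : fixedPoly k (1 : Equiv.Perm (Fin n)) = (∑ j, MvPolynomial.X j) ^ n := by
    rw [Fintype.sum_pow, fixedPoly]
    simp only [Equiv.Perm.coe_one, Function.comp_id, Finset.filter_true, content,
      MvPolynomial.monomial_sum_one]
    rfl
  have h2 := MvPolynomial.coeff_sum_X_pow_of_fintype (R := ℤ) α n
  rw [← h1, coeff_fixedPoly, if_pos (by simpa [Finsupp.sum_fintype] using hα)] at h2
  rw [h2, Finsupp.multinomial_eq_of_support_subset (Finset.subset_univ _), ← hα]
  exact_mod_cast (mul_comm _ _).trans (Nat.multinomial_spec univ α)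

/-- Falling factorials are monic of each degree, so they may replace powers in the Vandermonde
determinant. Its expansion then matches the multinomial degrees in `frob_eq_sum` term by term, a
falling factorial vanishing exactly where the guard fails. -/
theorem prod_factorial_mul_frob_one {k n : ℕ} (l : Fin k → ℕ)
    (hl : ∑ j, l j = n + ∑ j : Fin k, (j : ℕ)) :
    (∏ j, ((l j).factorial : ℤ)) * frob l (1 : Equiv.Perm (Fin n)) =
      n.factorial * (Matrix.vandermonde fun j => (l j : ℤ)).det := by
  have h1 : (Matrix.vandermonde fun j => (l j : ℤ)).det =
      (Matrix.of fun i j : Fin k => ((l i).descFactorial j : ℤ)).det := by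
    rw [Matrix.det_eval_matrixOfPolynomials_eq_det_vandermonde (fun i => (l i : ℤ))
      (fun i => descPochhammer ℤ i) (fun i => descPochhammer_natDegree ℤ i)
      (fun i => monic_descPochhammer ℤ i)]
    congr 1
    ext i j
    simp [descPochhammer_eval_eq_descFactorial]
  rw [h1, ← Matrix.det_transpose, Matrix.det_apply, frob_eq_sum, Finset.mul_sum, Finset.mul_sum]
  refine Finset.sum_congr rfl fun w _ => ?_
  rw [Units.smul_def, smul_eq_mul, mul_left_comm, mul_left_comm (n.factorial : ℤ)]
  congr 1
  simp only [Matrix.transpose_apply, Matrix.of_apply]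
  split_ifs with hw
  · have hw' : ∀ j, (w j : ℕ) ≤ l j := hw
    have hs : ∑ j, (Finsupp.equivFunOnFinite.symm l - permExp w) j = n := by
      have h1 : ∑ j, (Finsupp.equivFunOnFinite.symm l - permExp w) j + ∑ j, permExp w j =
          ∑ j, l j := by
        rw [← Finset.sum_add_distrib]
        exact Finset.sum_congr rfl fun j _ => Nat.sub_add_cancel (hw j)
      rw [sum_permExp, hl] at h1
      omega
    have h2 : ∀ j, ((l j).factorial : ℤ) = (((Finsupp.equivFunOnFinite.symm l - permExp w) j).factorial : ℤ) *
        ((l j).descFactorial (w j) : ℤ) := by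
      intro j
      exact_mod_cast (Nat.factorial_mul_descFactorial (hw' j)).symm
    rw [Finset.prod_congr rfl fun j _ => h2 j, Finset.prod_mul_distrib,
      ← permChar_one _ hs]
    ring
  · obtain ⟨j, hj⟩ : ∃ j, ¬ (w j : ℕ) ≤ l j := by
      by_contra h
      push Not at h
      exact hw fun j => h j
    have h0 : ∏ i, ((l i).descFactorial (w i) : ℤ) = 0 :=
      Finset.prod_eq_zero (Finset.mem_univ j) (by
        rw [Nat.descFactorial_eq_zero_iff_lt.2 (not_le.1 hj)]; rfl)
    rw [h0]
    simp

theorem det_vandermonde_pos {k : ℕ} {l : Fin k → ℕ} (hl : StrictMono l) :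
    0 < (Matrix.vandermonde fun j => (l j : ℤ)).det := by
  rw [Matrix.det_vandermonde]
  refine Finset.prod_pos fun i _ => Finset.prod_pos fun j hj => ?_
  have := hl (Finset.mem_Ioi.1 hj)
  simpa using this

theorem frob_one_pos {k n : ℕ} {l : Fin k → ℕ} (hl : StrictMono l)
    (hsum : ∑ j, l j = n + ∑ j : Fin k, (j : ℕ)) : 0 < frob l (1 : Equiv.Perm (Fin n)) := by
  have h := prod_factorial_mul_frob_one l hsum
  have h2 : 0 < (n.factorial : ℤ) * (Matrix.vandermonde fun j => (l j : ℤ)).det :=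
    mul_pos (by exact_mod_cast n.factorial_pos) (det_vandermonde_pos hl)
  rw [← h] at h2
  exact pos_of_mul_pos_right h2 (Finset.prod_nonneg fun _ _ => by positivity)

/-- Permuting the exponents of a Frobenius function multiplies it by the sign. -/
theorem frob_comp_perm {k n : ℕ} (l : Fin k → ℕ) (w : Equiv.Perm (Fin k))
    (g : Equiv.Perm (Fin n)) : frob (l ∘ w) g = (Equiv.Perm.sign w : ℤ) * frob l g := by
  have hcomp : ∀ f : Fin n → Fin k, (content f).mapDomain w = content (w ∘ f) := fun f => by
    simp [content, Finsupp.mapDomain_finsetSum]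
  -- The fixed-colouring polynomial is symmetric and the Vandermonde determinant alternating, so
  -- renaming variables multiplies the product by the sign.
  have hfix : MvPolynomial.rename w (fixedPoly k g) = fixedPoly k g := by
    rw [fixedPoly, map_sum]
    refine Finset.sum_bij' (fun f _ => w ∘ f) (fun f _ => w.symm ∘ f) ?_ ?_ ?_ ?_ ?_
    · intro f hf
      simp only [mem_filter, mem_univ, true_and] at hf ⊢
      rw [Function.comp_assoc, hf]
    · intro f hf
      simp only [mem_filter, mem_univ, true_and] at hf ⊢
      rw [Function.comp_assoc, hf]
    · intro f _
      funext i
      simp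
    · intro f _
      funext i
      simp
    · intro f _
      rw [MvPolynomial.rename_monomial, hcomp]
  have hvdm : MvPolynomial.rename w (vdm k) = (Equiv.Perm.sign w : ℤ) • vdm k := by
    rw [vdm, alternant, AlgHom.map_det, zsmul_eq_mul, ← Matrix.det_permute]
    congr 1
    ext1 i j
    simp
  have h := MvPolynomial.coeff_rename_mapDomain w w.injective (vdm k * fixedPoly k g)
    (Finsupp.equivFunOnFinite.symm (l ∘ w))
  have hl : (Finsupp.equivFunOnFinite.symm (l ∘ w)).mapDomain w = Finsupp.equivFunOnFinite.symm l := by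
    ext i
    rw [Finsupp.mapDomain_equiv_apply]
    simp
  rw [map_mul, hfix, hvdm, smul_mul_assoc, hl, MvPolynomial.coeff_smul, smul_eq_mul] at h
  exact h.symm

/-- A repeated exponent would make the value equal to its own negative; distinct exponents can be
sorted. -/
theorem exists_strictMono_of_frob_ne_zero {k n : ℕ} (l : Fin k → ℕ) (g : Equiv.Perm (Fin n))
    (h : frob l g ≠ 0) : ∃ w : Equiv.Perm (Fin k), StrictMono (l ∘ w) := by
  have hinj : Function.Injective l := by
    intro a b hab
    by_contra hne
    have h1 := frob_comp_perm l (Equiv.swap a b) g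
    have h2 : l ∘ Equiv.swap a b = l := by
      funext i
      simp only [Function.comp_apply, Equiv.swap_apply_def]
      split_ifs with h h' <;> simp_all
    rw [h2, Equiv.Perm.sign_swap hne] at h1
    simp at h1
    omega
  exact ⟨Tuple.sort l, (Tuple.monotone_sort l).strictMono_of_injective
    (hinj.comp (Tuple.sort l).injective)⟩

/-! ### Irreducible and virtual characters of a finite group. -/

section General

noncomputable instance irrFintype (G : Type) [Group G] [Finite G] : Fintype (Irr G) :=
  @Fintype.ofFinite _ (Irr.finite G)

variable {G : Type} [Group G]

/-- The character of an isomorphism class of irreducible representations. -/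
noncomputable def irrChar (x : Irr G) (g : G) : ℂ := x.out.rep.character g

theorem irrChar_mk (V : IrrepData G) (g : G) :
    irrChar (Quotient.mk (IrrepData.isoSetoid G) V) g = V.rep.character g := by
  obtain ⟨e⟩ := Quotient.mk_out (s := IrrepData.isoSetoid G) V
  exact congrFun (Representation.char_iso e) g

theorem dim_out (x : Irr G) : x.out.dim = x.dim := by
  conv_rhs => rw [← Quotient.out_eq x]
  rfl

theorem irrChar_one (x : Irr G) : irrChar x 1 = x.dim := by
  rw [irrChar, Representation.char_one, ← dim_out]
  simp

theorem dim_pos (x : Irr G) : 0 < x.dim := by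
  rw [← dim_out]
  by_contra h
  have h0 : x.out.dim = 0 := by omega
  have : Subsingleton (Fin x.out.dim → ℂ) := by
    rw [h0]; infer_instance
  have hn := x.out.irreducible.toNontrivial
  obtain ⟨a, b, hab⟩ := hn
  exact hab (Subrepresentation.toSubmodule_injective (Subsingleton.elim _ _))

theorem isIrreducible_of_equiv {V W : Type} [AddCommGroup V] [Module ℂ V] [AddCommGroup W]
    [Module ℂ W] {ρ : Representation ℂ G V} {σ : Representation ℂ G W} (e : ρ.Equiv σ)
    (h : ρ.IsIrreducible) : σ.IsIrreducible := by
  have hcomm : ∀ g v, e.toLinearEquiv (ρ g v) = σ g (e.toLinearEquiv v) := fun g v =>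
    Representation.IntertwiningMap.isIntertwining ρ σ e.toIntertwiningMap g v
  let F : Subrepresentation ρ ≃o Subrepresentation σ :=
    { toFun := fun U => ⟨U.toSubmodule.map e.toLinearEquiv.toLinearMap, by
        rintro g _ ⟨v, hv, rfl⟩
        exact ⟨ρ g v, U.apply_mem_toSubmodule g hv, hcomm g v⟩⟩
      invFun := fun U => ⟨U.toSubmodule.comap e.toLinearEquiv.toLinearMap, by
        intro g v hv
        have : e.toLinearEquiv (ρ g v) ∈ U.toSubmodule := by
          rw [hcomm]
          exact U.apply_mem_toSubmodule g hv
        exact this⟩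
      left_inv := fun U => Subrepresentation.toSubmodule_injective
        (Submodule.comap_map_eq_of_injective e.toLinearEquiv.injective _)
      right_inv := fun U => Subrepresentation.toSubmodule_injective
        (Submodule.map_comap_eq_of_surjective e.toLinearEquiv.surjective _)
      map_rel_iff' := by
        intro U U'
        exact Submodule.map_le_map_iff_of_injective e.toLinearEquiv.injective _ _ }
  exact F.symm.isSimpleOrder_iff.2 h

theorem exists_irr {V : Type} [AddCommGroup V] [Module ℂ V] [FiniteDimensional ℂ V]
    (ρ : Representation ℂ G V) (h : ρ.IsIrreducible) :
    ∃ x : Irr G, Nonempty (ρ.Equiv x.out.rep) ∧ ∀ g, irrChar x g = ρ.character g := by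
  let e : V ≃ₗ[ℂ] (Fin (Module.finrank ℂ V) → ℂ) :=
    LinearEquiv.ofFinrankEq _ _ (by simp)
  let σ : Representation ℂ G (Fin (Module.finrank ℂ V) → ℂ) :=
    { toFun := fun g => e.conj (ρ g)
      map_one' := by ext; simp
      map_mul' := fun a b => by ext; simp }
  let E : ρ.Equiv σ := Representation.Equiv.mk e fun g => by
    ext v
    simp [σ, LinearEquiv.conj_apply]
  let D : IrrepData G := ⟨_, σ, isIrreducible_of_equiv E h⟩
  refine ⟨Quotient.mk (IrrepData.isoSetoid G) D, ?_, fun g => ?_⟩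
  · obtain ⟨f⟩ := Quotient.mk_out (s := IrrepData.isoSetoid G) D
    exact ⟨E.trans f.symm⟩
  · rw [irrChar_mk]
    exact (congrFun (Representation.char_iso E) g).symm

variable [Fintype G]

theorem sum_irrChar_mul_irrChar [DecidableEq (Irr G)] (x y : Irr G) :
    ∑ g : G, irrChar x g * irrChar y g⁻¹ = if x = y then (Fintype.card G : ℂ) else 0 := by
  have hcard : (Nat.card G : ℂ) ≠ 0 := Nat.cast_ne_zero.mpr Nat.card_pos.ne'
  let _ : Invertible (Nat.card G : ℂ) := invertibleOfNonzero hcard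
  have := x.out.irreducible
  have := y.out.irreducible
  have h := Representation.char_orthonormal x.out.rep y.out.rep
  have hiff : Nonempty (y.out.rep.Equiv x.out.rep) ↔ x = y := by
    rw [eq_comm]
    exact Quotient.out_equiv_out (s := IrrepData.isoSetoid G) (x := y) (y := x)
  rw [inv_mul_eq_iff_eq_mul₀ hcard] at h
  refine h.trans ?_
  simp only [hiff]
  split_ifs <;> simp

/-- Virtual characters: integral combinations of irreducible characters. -/
def IsVirtual (φ : G → ℂ) : Prop := ∃ c : Irr G → ℤ, ∀ g, φ g = ∑ x, (c x : ℂ) * irrChar x g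

theorem IsVirtual.add {φ ψ : G → ℂ} (h : IsVirtual φ) (h' : IsVirtual ψ) :
    IsVirtual fun g => φ g + ψ g := by
  obtain ⟨c, hc⟩ := h
  obtain ⟨d, hd⟩ := h'
  exact ⟨fun x => c x + d x, fun g => by simp [hc, hd, add_mul, Finset.sum_add_distrib]⟩

theorem isVirtual_zero : IsVirtual fun _ : G => (0 : ℂ) := ⟨0, by simp⟩

theorem IsVirtual.int_mul {φ : G → ℂ} (h : IsVirtual φ) (m : ℤ) :
    IsVirtual fun g => (m : ℂ) * φ g := by
  obtain ⟨c, hc⟩ := h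
  exact ⟨fun x => m * c x, fun g => by simp [hc, Finset.mul_sum, mul_assoc]⟩

theorem IsVirtual.sum {ι : Type*} (s : Finset ι) {φ : ι → G → ℂ} (h : ∀ i ∈ s, IsVirtual (φ i)) :
    IsVirtual fun g => ∑ i ∈ s, φ i g := by
  classical
  induction s using Finset.induction_on with
  | empty => simpa using isVirtual_zero
  | insert a s ha ih =>
    simp only [Finset.sum_insert ha]
    exact (h a (by simp)).add (ih fun i hi => h i (by simp [hi]))

theorem isVirtual_irrChar (x : Irr G) : IsVirtual (irrChar x) := by
  classical
  exact ⟨Pi.single x 1, fun g => by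
    rw [Finset.sum_eq_single x] <;> simp +contextual⟩

omit [Fintype G] in
theorem isCompl_toSubmodule {V : Type} [AddCommGroup V] [Module ℂ V]
    {ρ : Representation ℂ G V} {U U' : Subrepresentation ρ} (h : IsCompl U U') :
    IsCompl U.toSubmodule U'.toSubmodule := by
  constructor
  · rw [disjoint_iff, ← Subrepresentation.toSubmodule_inf, h.inf_eq_bot]
    rfl
  · rw [codisjoint_iff, ← Subrepresentation.toSubmodule_sup, h.sup_eq_top]
    rfl

omit [Fintype G] in
theorem character_eq_add {V : Type} [AddCommGroup V] [Module ℂ V] [FiniteDimensional ℂ V]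
    {ρ : Representation ℂ G V} {U U' : Subrepresentation ρ} (h : IsCompl U U') (g : G) :
    ρ.character g = U.toRepresentation.character g + U'.toRepresentation.character g := by
  let e := Submodule.prodEquivOfIsCompl _ _ (isCompl_toSubmodule h)
  have : ρ g = e.conj ((U.toRepresentation g).prodMap (U'.toRepresentation g)) := by
    ext v
    obtain ⟨⟨a, b⟩, rfl⟩ := e.surjective v
    rw [LinearEquiv.conj_apply_apply, e.symm_apply_apply, LinearMap.prodMap_apply]
    simp only [e, Submodule.coe_prodEquivOfIsCompl', map_add]
    rfl
  rw [Representation.character, this, LinearMap.trace_conj', LinearMap.trace_prodMap']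
  rfl

instance neZero_card : NeZero (Nat.card G : ℂ) := ⟨Nat.cast_ne_zero.mpr Nat.card_pos.ne'⟩

/-- Complete reducibility, by splitting off a proper subrepresentation and inducting on dimension.
-/
theorem isVirtual_character {V : Type} [AddCommGroup V] [Module ℂ V] [FiniteDimensional ℂ V]
    (ρ : Representation ℂ G V) : IsVirtual ρ.character := by
  induction hd : Module.finrank ℂ V using Nat.strong_induction_on generalizing V with
  | _ d ih =>
  rcases subsingleton_or_nontrivial V with hV | hV
  · have : ρ.character = fun _ => 0 := by
      funext g
      rw [Representation.character, Subsingleton.elim (ρ g) 0, map_zero]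
    rw [this]
    exact isVirtual_zero
  by_cases hirr : ρ.IsIrreducible
  · obtain ⟨x, -, hx⟩ := exists_irr ρ hirr
    rw [← funext hx]
    exact isVirtual_irrChar x
  · have hnt : Nontrivial (Subrepresentation ρ) := by
      refine ⟨⊥, ⊤, fun h => ?_⟩
      have : (⊥ : Submodule ℂ V) = ⊤ := congrArg Subrepresentation.toSubmodule h
      exact bot_ne_top this
    obtain ⟨U, hU0, hU1⟩ : ∃ U : Subrepresentation ρ, U ≠ ⊥ ∧ U ≠ ⊤ := by
      by_contra hcon
      push Not at hcon
      exact hirr { eq_bot_or_eq_top := fun U => or_iff_not_imp_left.2 (hcon U) }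
    obtain ⟨U', hUU'⟩ := exists_isCompl U
    have hlt : ∀ W : Subrepresentation ρ, W ≠ ⊤ → Module.finrank ℂ W.toSubmodule < d := by
      intro W hW
      rw [← hd]
      exact Submodule.finrank_lt fun h => hW (Subrepresentation.toSubmodule_injective h)
    have hU1' : U' ≠ ⊤ := fun h => hU0 (by simpa [h] using hUU'.inf_eq_bot)
    rw [funext (character_eq_add hUU')]
    exact (ih _ (hlt U hU1) U.toRepresentation rfl).add (ih _ (hlt U' hU1') U'.toRepresentation rfl)

/-- A virtual character of norm one and positive degree is irreducible. -/
theorem IsVirtual.exists_eq_irrChar {φ : G → ℂ} (h : IsVirtual φ)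
    (hnorm : ∑ g, φ g * φ g⁻¹ = Fintype.card G) (hpos : 0 < (φ 1).re) :
    ∃ x : Irr G, ∀ g, irrChar x g = φ g := by
  classical
  obtain ⟨c, hc⟩ := h
  have hG : (Fintype.card G : ℂ) ≠ 0 := Nat.cast_ne_zero.2 Fintype.card_ne_zero
  -- Orthonormality turns the norm into a sum of integer squares, so one coefficient is ±1 and the
  -- others vanish; the positive degree excludes −1.
  have h1 : ∑ x, (c x) ^ 2 = 1 := by
    have : ∑ g, φ g * φ g⁻¹ = Fintype.card G * ∑ x, (c x : ℂ) ^ 2 := by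
      simp only [hc, Finset.sum_mul_sum]
      rw [Finset.sum_comm]
      simp_rw [Finset.sum_comm (s := (univ : Finset G))]
      have : ∀ x y : Irr G, ∑ g, (c x : ℂ) * irrChar x g * ((c y : ℂ) * irrChar y g⁻¹) =
          c x * c y * if x = y then (Fintype.card G : ℂ) else 0 := by
        intro x y
        rw [← sum_irrChar_mul_irrChar, Finset.mul_sum]
        exact Finset.sum_congr rfl fun g _ => by ring
      simp only [this]
      simp [Finset.mul_sum, pow_two, mul_comm]
    rw [hnorm] at this
    have h2 : (∑ x, (c x : ℂ) ^ 2) = 1 := by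
      field_simp at this
      exact this.symm
    exact_mod_cast h2
  obtain ⟨x, hx⟩ : ∃ x, c x ≠ 0 := by
    by_contra hcon
    push Not at hcon
    simp [hcon] at h1
  have h2 : ∀ y, y ≠ x → c y = 0 := by
    intro y hy
    have h3 : c x ^ 2 + c y ^ 2 ≤ 1 := by
      rw [← h1, ← Finset.sum_pair (f := fun z => c z ^ 2) hy.symm]
      exact Finset.sum_le_sum_of_subset_of_nonneg (Finset.subset_univ _) fun _ _ _ => sq_nonneg _
    have h4 : 1 ≤ c x ^ 2 := by
      have := sq_nonneg (c x)
      have : c x ^ 2 ≠ 0 := pow_ne_zero _ hx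
      omega
    have h5 : c y ^ 2 ≤ 0 := by omega
    exact pow_eq_zero_iff (two_ne_zero) |>.1 (le_antisymm h5 (sq_nonneg _))
  have h3 : ∀ g, φ g = c x * irrChar x g := by
    intro g
    rw [hc, Finset.sum_eq_single x (fun y _ hy => by simp [h2 y hy]) (by simp)]
  have h4 : c x ^ 2 = 1 := by
    rw [← h1, Finset.sum_eq_single x (fun y _ hy => by simp [h2 y hy]) (by simp)]
  refine ⟨x, fun g => ?_⟩
  rcases (sq_eq_sq_iff_eq_or_eq_neg.1 (h4.trans (one_pow 2).symm)) with h5 | h5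
  · rw [h3, h5]; simp
  · exfalso
    rw [h3, h5, irrChar_one] at hpos
    simp at hpos
    linarith [(Nat.cast_nonneg x.dim : (0 : ℝ) ≤ x.dim)]

end General

/-! ### Frobenius functions are irreducible characters. -/

/-- The permutation representation on functions of colourings with content `α`. -/
noncomputable def colouringRep {k n : ℕ} (α : Fin k →₀ ℕ) :
    Representation ℂ (Equiv.Perm (Fin n)) ({f : Fin n → Fin k // content f = α} → ℂ) where
  toFun g := LinearMap.funLeft ℂ ℂ fun f => ⟨f.1 ∘ g, by rw [content_comp_perm, f.2]⟩
  map_one' := by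
    ext; simp [LinearMap.funLeft_apply]
  map_mul' a b := by
    refine LinearMap.ext fun v => funext fun f => ?_
    rfl

theorem colouringRep_character {k n : ℕ} (α : Fin k →₀ ℕ) (g : Equiv.Perm (Fin n)) :
    (colouringRep α).character g = permChar α g := by
  classical
  rw [Representation.character, LinearMap.trace_eq_matrix_trace ℂ (Pi.basisFun ℂ _), Matrix.trace]
  have h : ∀ f : {f : Fin n → Fin k // content f = α},
      (LinearMap.toMatrix (Pi.basisFun ℂ _) (Pi.basisFun ℂ _) (colouringRep α g)).diag f =
        if f.1 ∘ g = f.1 then 1 else 0 := by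
    intro f
    rw [Matrix.diag_apply, LinearMap.toMatrix_apply, Pi.basisFun_apply, Pi.basisFun_repr]
    change Pi.single (M := fun _ => ℂ) f (1 : ℂ) ⟨f.1 ∘ g, _⟩ = _
    rw [Pi.single_apply]
    simp [Subtype.ext_iff]
  rw [Finset.sum_congr rfl fun f _ => h f, Finset.sum_boole, permChar]
  norm_cast
  rw [← Finset.card_map (Function.Embedding.subtype _)]
  congr 1
  ext f
  simp [and_comm]

theorem isVirtual_permChar {k n : ℕ} (α : Fin k →₀ ℕ) :
    IsVirtual fun g : Equiv.Perm (Fin n) => (permChar α g : ℂ) := by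
  simp only [← colouringRep_character]
  exact isVirtual_character (colouringRep α)

theorem isVirtual_frob {k n : ℕ} (l : Fin k → ℕ) :
    IsVirtual fun g : Equiv.Perm (Fin n) => (frob l g : ℂ) := by
  simp only [frob_eq_sum, Int.cast_sum, Int.cast_mul]
  refine IsVirtual.sum _ fun w _ => IsVirtual.int_mul ?_ _
  split_ifs
  · exact isVirtual_permChar _
  · simpa using isVirtual_zero

theorem comp_inv_eq_iff {κ : Type*} {n : ℕ} (f : Fin n → κ) (g : Equiv.Perm (Fin n)) :
    f ∘ ⇑g⁻¹ = f ↔ f ∘ g = f := by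
  constructor <;> intro h
  · conv_lhs => rw [← h]
    funext i; simp
  · conv_lhs => rw [← h]
    funext i; simp

theorem fixedPoly_inv {k n : ℕ} (g : Equiv.Perm (Fin n)) : fixedPoly k g⁻¹ = fixedPoly k g := by
  simp only [fixedPoly, comp_inv_eq_iff]

/-- Reconciles `sum_frob_mul_frob` with the orthogonality relations, which pair values at g and g⁻¹.
-/
theorem frob_inv {k n : ℕ} (l : Fin k → ℕ) (g : Equiv.Perm (Fin n)) : frob l g⁻¹ = frob l g := by
  rw [frob, fixedPoly_inv, frob]

/-- Frobenius functions with increasing exponents are irreducible characters. -/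
theorem exists_irrChar_eq_frob {k n : ℕ} {l : Fin k → ℕ} (hl : StrictMono l)
    (hsum : ∑ j, l j = n + ∑ j : Fin k, (j : ℕ)) :
    ∃ x : Irr (Equiv.Perm (Fin n)), ∀ g, irrChar x g = frob l g := by
  refine (isVirtual_frob l).exists_eq_irrChar ?_ ?_
  · have := sum_frob_mul_frob hl hl hsum
    simp only [frob_inv, Fintype.card_perm, Fintype.card_fin, if_true] at this ⊢
    exact_mod_cast this
  · have := frob_one_pos hl hsum
    simpa using this

theorem sum_content_of_frob_ne_zero {k n : ℕ} (l : Fin k → ℕ) (g : Equiv.Perm (Fin n))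
    (h : frob l g ≠ 0) : ∑ j, l j = n + ∑ j : Fin k, (j : ℕ) := by
  rw [frob_eq_sum] at h
  obtain ⟨w, -, hw⟩ := Finset.exists_ne_zero_of_sum_ne_zero h
  split_ifs at hw with hle
  · have h1 : permChar (Finsupp.equivFunOnFinite.symm l - permExp w) g ≠ 0 := right_ne_zero_of_mul hw
    rw [permChar, Nat.cast_ne_zero, Finset.card_ne_zero] at h1
    obtain ⟨f, hf⟩ := h1
    have h2 := sum_content f
    rw [(Finset.mem_filter.1 hf).2.2] at h2
    have h3 : ∑ j, (Finsupp.equivFunOnFinite.symm l - permExp w) j + ∑ j, permExp w j =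
        ∑ j, l j := by
      rw [← Finset.sum_add_distrib]
      exact Finset.sum_congr rfl fun j _ => Nat.sub_add_cancel (hle j)
    rw [← h3, h2, sum_permExp]
  · simp at hw

/-! ### Fixed vectors of point stabilisers and the first row. -/

/-- The pointwise stabiliser of `B` has a nonzero fixed vector, for some `B` of size `b`. -/
def HasFixed {n : ℕ} (x : Irr (Equiv.Perm (Fin n))) (b : ℕ) : Prop :=
  ∃ B : Finset (Fin n), #B = b ∧ ∃ v ≠ 0, ∀ g : Equiv.Perm (Fin n), (∀ i ∈ B, g i = i) →
    x.out.rep g v = v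

/-- The sum equals ∑ |H_f| · dim V^{H_f} over colourings `f` of content `α`, with H_f the stabiliser
of `f`. All terms are natural numbers, so nothing cancels. -/
theorem sum_permChar_mul_character_ne_zero_iff {k n d : ℕ} (α : Fin k →₀ ℕ)
    (ρ : Representation ℂ (Equiv.Perm (Fin n)) (Fin d → ℂ)) :
    ∑ g, (permChar α g : ℂ) * ρ.character g ≠ 0 ↔
      ∃ f : Fin n → Fin k, content f = α ∧ ∃ v ≠ 0, ∀ g : Equiv.Perm (Fin n), f ∘ g = f →
        ρ g v = v := by
  classical
  let H : (Fin n → Fin k) → Subgroup (Equiv.Perm (Fin n)) := fun f =>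
    { carrier := {g | f ∘ g = f}
      one_mem' := by simp
      mul_mem' := by
        intro a b ha hb
        simp only [Set.mem_ofPred_eq] at *
        rw [Equiv.Perm.coe_mul, ← Function.comp_assoc, ha, hb]
      inv_mem' := by
        intro a ha
        exact (comp_inv_eq_iff f a).2 ha }
  have hmem : ∀ f g, g ∈ H f ↔ f ∘ g = f := fun _ _ => Iff.rfl
  let τ : ∀ f, Representation ℂ (H f) (Fin d → ℂ) := fun f => ρ.comp (H f).subtype
  let m : (Fin n → Fin k) → ℕ := fun f =>
    Nat.card (H f) * Module.finrank ℂ (τ f).invariants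
  have hm : ∀ f, ∑ g ∈ ({g | f ∘ g = f} : Finset (Equiv.Perm (Fin n))), ρ.character g = m f := by
    intro f
    have hcard : (Nat.card (H f) : ℂ) ≠ 0 := Nat.cast_ne_zero.mpr Nat.card_pos.ne'
    let _ : Invertible (Nat.card (H f) : ℂ) := invertibleOfNonzero hcard
    have h := (τ f).card_inv_mul_sum_char_eq_finrank
    rw [inv_mul_eq_iff_eq_mul₀ hcard] at h
    simp only [m]
    push_cast
    rw [← h]
    exact Finset.sum_subtype _ (by simp [hmem]) _
  have hsum : ∑ g, (permChar α g : ℂ) * ρ.character g =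
      ((∑ f : Fin n → Fin k with content f = α, m f : ℕ) : ℂ) := by
    push_cast
    simp only [← hm, permChar, Finset.sum_filter, Finset.card_filter, Int.cast_sum, Nat.cast_sum,
      Finset.sum_mul]
    rw [Finset.sum_comm]
    refine Finset.sum_congr rfl fun f _ => ?_
    by_cases hf : content f = α <;> simp [hf]
  have hpos : ∀ f, m f ≠ 0 ↔ ∃ v ≠ 0, ∀ g : Equiv.Perm (Fin n), f ∘ g = f → ρ g v = v := by
    intro f
    have h1 : m f ≠ 0 ↔ (τ f).invariants ≠ ⊥ := by
      rw [Ne, Ne, ← Submodule.finrank_eq_zero]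
      simp [m]
    rw [h1, Submodule.ne_bot_iff]
    constructor
    · rintro ⟨v, hv, hv0⟩
      exact ⟨v, hv0, fun g hg => hv ⟨g, hg⟩⟩
    · rintro ⟨v, hv0, hv⟩
      exact ⟨v, fun g => hv g.1 g.2, hv0⟩
  rw [hsum, Nat.cast_ne_zero, Ne, Finset.sum_eq_zero_iff]
  push Not
  simp only [mem_filter, mem_univ, true_and, hpos]

theorem HasFixed.exists_permChar {n K b : ℕ} {x : Irr (Equiv.Perm (Fin n))} (h : HasFixed x b)
    (hb : b ≤ K) : ∃ α : Fin (K + 1) →₀ ℕ, α (Fin.last K) = n - b ∧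
      ∑ g, (permChar α g : ℂ) * irrChar x g ≠ 0 := by
  classical
  obtain ⟨B, hB, v, hv0, hv⟩ := h
  subst hB
  -- Give the points of `B` distinct colours and all others the last colour: a permutation fixing
  -- this colouring fixes `B` pointwise.
  let e : B ↪ Fin K := B.equivFin.toEmbedding.trans (Fin.castLEEmb hb)
  let f : Fin n → Fin (K + 1) := fun i => if hi : i ∈ B then (e ⟨i, hi⟩).castSucc else Fin.last K
  have hlast : ∀ i, f i = Fin.last K ↔ i ∉ B := by
    intro i
    by_cases hi : i ∈ B
    · simp [f, hi, (Fin.castSucc_lt_last _).ne]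
    · simp [f, hi]
  refine ⟨content f, ?_, ?_⟩
  · rw [content_apply]
    simp only [hlast]
    rw [← Finset.compl_filter]
    simp [Finset.card_compl]
  · refine (sum_permChar_mul_character_ne_zero_iff _ _).2 ⟨f, rfl, v, hv0, fun g hg => hv g ?_⟩
    intro i hi
    have h1 : f (g i) = f i := congrFun hg i
    have h2 : g i ∈ B := by
      by_contra h2
      rw [(hlast _).2 h2] at h1
      exact (hlast i).1 h1.symm hi
    simp only [f, dif_pos hi, dif_pos h2, Fin.castSucc_inj] at h1
    exact congrArg Subtype.val (e.injective h1)

theorem hasFixed_of_permChar {n K : ℕ} {x : Irr (Equiv.Perm (Fin n))} (α : Fin (K + 1) →₀ ℕ)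
    (h : ∑ g, (permChar α g : ℂ) * irrChar x g ≠ 0) : HasFixed x (n - α (Fin.last K)) := by
  classical
  obtain ⟨f, rfl, v, hv0, hv⟩ := (sum_permChar_mul_character_ne_zero_iff _ _).1 h
  refine ⟨({i | f i ≠ Fin.last K} : Finset _), ?_, v, hv0, fun g hg => hv g ?_⟩
  · rw [content_apply]
    simp only [ne_eq]
    rw [← Finset.compl_filter, Finset.card_compl, Fintype.card_fin]
  · simp only [mem_filter, mem_univ, true_and] at hg
    funext i
    by_cases hi : f i = Fin.last K
    · rw [Function.comp_apply, hi]
      by_contra hne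
      have := g.injective (hg (g i) hne)
      rw [this] at hne
      exact hne hi
    · rw [Function.comp_apply, hg i hi]

theorem degreeOf_last_alternant {K : ℕ} {l : Fin (K + 1) → ℕ} (hl : StrictMono l) :
    (alternant l).degreeOf (Fin.last K) = l (Fin.last K) := by
  classical
  apply le_antisymm
  · rw [alternant_eq_sum, MvPolynomial.degreeOf_le_iff]
    intro m hm
    obtain ⟨w, -, hw⟩ := Finset.mem_biUnion.1 (MvPolynomial.support_sum hm)
    have := MvPolynomial.support_monomial_subset (MvPolynomial.support_smul hw)
    rw [Finset.mem_singleton] at this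
    subst this
    exact hl.monotone (Fin.le_last _)
  · have h : (alternant l).coeff (Finsupp.equivFunOnFinite.symm l) ≠ 0 := by
      rw [coeff_alternant hl hl]; simp
    exact MvPolynomial.monomial_le_degreeOf (Fin.last K) (MvPolynomial.mem_support_iff.2 h)

/-- Degrees in one variable add in `alternant_eq`. The resulting degree is the first part λ₁ of the
partition with beta-set `l`. -/
theorem degreeOf_last_schur {K : ℕ} {l : Fin (K + 1) → ℕ} (hl : StrictMono l) :
    (schur l).degreeOf (Fin.last K) + K = l (Fin.last K) := by
  have h0 : alternant l ≠ 0 := by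
    intro h
    have := coeff_alternant hl hl
    rw [h] at this
    simp at this
  have h1 := degreeOf_last_alternant hl
  rw [alternant_eq] at h0 h1
  rw [MvPolynomial.degreeOf_mul_eq (left_ne_zero_of_mul h0) (right_ne_zero_of_mul h0), vdm,
    degreeOf_last_alternant Fin.val_strictMono] at h1
  rw [← h1, add_comm]
  simp

theorem sum_permChar_mul_frob {k n : ℕ} (α : Fin k →₀ ℕ) (l : Fin k → ℕ)
    (hsum : ∑ j, l j = n + ∑ j : Fin k, (j : ℕ)) :
    ∑ g : Equiv.Perm (Fin n), permChar α g * frob l g = n.factorial * (schur l).coeff α := by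
  have h := congrArg (fun p => p.coeff α) (sum_frob_smul_fixedPoly l hsum)
  simp only [MvPolynomial.coeff_sum, MvPolynomial.coeff_smul, coeff_fixedPoly, smul_eq_mul] at h
  rw [← h]
  exact Finset.sum_congr rfl fun g _ => mul_comm _ _

theorem sum_permChar_mul_irrChar_ne_zero_iff {k n : ℕ} {x : Irr (Equiv.Perm (Fin n))}
    {l : Fin k → ℕ} (hsum : ∑ j, l j = n + ∑ j : Fin k, (j : ℕ))
    (hx : ∀ g, irrChar x g = frob l g) (α : Fin k →₀ ℕ) :
    ∑ g, (permChar α g : ℂ) * irrChar x g ≠ 0 ↔ (schur l).coeff α ≠ 0 := by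
  have h : ∑ g, (permChar α g : ℂ) * irrChar x g = ((n.factorial * (schur l).coeff α : ℤ) : ℂ) := by
    rw [← sum_permChar_mul_frob α l hsum]
    push_cast
    exact Finset.sum_congr rfl fun g _ => by rw [hx]
  rw [h, Int.cast_ne_zero, mul_ne_zero_iff]
  simp [n.factorial_ne_zero]

/-- A monomial of the Schur polynomial attaining degree λ₁ in the last variable gives a colouring
with n − λ₁ points outside the last colour. `HasFixed.le_of_eq_frob` uses the same degree as an
upper bound. -/
theorem hasFixed_of_eq_frob {n K : ℕ} {x : Irr (Equiv.Perm (Fin n))} {l : Fin (K + 1) → ℕ}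
    (hl : StrictMono l) (hsum : ∑ j, l j = n + ∑ j : Fin (K + 1), (j : ℕ))
    (hx : ∀ g, irrChar x g = frob l g) : HasFixed x (n - (l (Fin.last K) - K)) := by
  classical
  have h0 : schur l ≠ 0 := by
    intro h
    have := coeff_alternant hl hl
    rw [alternant_eq, h] at this
    simp at this
  obtain ⟨m, hm, hdeg⟩ := Finset.exists_mem_eq_sup (schur l).support
    (MvPolynomial.support_nonempty.2 h0) fun m => m (Fin.last K)
  rw [← MvPolynomial.degreeOf_eq_sup] at hdeg
  have h1 := degreeOf_last_schur hl
  have h2 : l (Fin.last K) - K = m (Fin.last K) := by omega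
  rw [h2]
  exact hasFixed_of_permChar m
    ((sum_permChar_mul_irrChar_ne_zero_iff hsum hx m).2 (MvPolynomial.mem_support_iff.1 hm))

theorem HasFixed.le_of_eq_frob {n K b : ℕ} {x : Irr (Equiv.Perm (Fin n))} {l : Fin (K + 1) → ℕ}
    (hl : StrictMono l) (hsum : ∑ j, l j = n + ∑ j : Fin (K + 1), (j : ℕ))
    (hx : ∀ g, irrChar x g = frob l g) (h : HasFixed x b) (hb : b ≤ K) :
    n - b + K ≤ l (Fin.last K) := by
  obtain ⟨α, hα, hne⟩ := h.exists_permChar hb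
  have h1 := MvPolynomial.monomial_le_degreeOf (Fin.last K) (MvPolynomial.mem_support_iff.2
    ((sum_permChar_mul_irrChar_ne_zero_iff hsum hx α).1 hne))
  rw [← degreeOf_last_schur hl, ← hα]
  omega

/-- The characteristic of `x` in K + 1 variables is nonzero, since some permutation character pairs
nontrivially with `x`. Its product with the Vandermonde determinant is then nonzero as well, so `x`
pairs nontrivially with some `frob`; after sorting this is an irreducible character, hence that of
`x`. -/
theorem HasFixed.exists_eq_frob {n K b : ℕ} {x : Irr (Equiv.Perm (Fin n))}
    (h : HasFixed x b) (hb : b ≤ K) : ∃ l : Fin (K + 1) → ℕ, StrictMono l ∧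
      ∑ j, l j = n + ∑ j : Fin (K + 1), (j : ℕ) ∧ ∀ g, irrChar x g = frob l g := by
  classical
  obtain ⟨α, -, hα⟩ := h.exists_permChar hb
  let φ : MvPolynomial (Fin (K + 1)) ℤ →+* MvPolynomial (Fin (K + 1)) ℂ :=
    MvPolynomial.map (Int.castRingHom ℂ)
  let Ψ : MvPolynomial (Fin (K + 1)) ℂ :=
    ∑ g, MvPolynomial.C (irrChar x g) * φ (fixedPoly (K + 1) g)
  have hΨ : Ψ ≠ 0 := by
    intro h0
    apply hα
    have := congrArg (MvPolynomial.coeff α) h0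
    simpa [Ψ, φ, MvPolynomial.coeff_sum, MvPolynomial.coeff_map, coeff_fixedPoly, mul_comm]
      using this
  have hv : φ (vdm (K + 1)) ≠ 0 := by
    rw [Ne, map_eq_zero_iff φ (MvPolynomial.map_injective _ Int.cast_injective)]
    exact vdm_ne_zero _
  obtain ⟨m, hm⟩ := MvPolynomial.ne_zero_iff.1 (mul_ne_zero hv hΨ)
  have hm' : ∑ g, irrChar x g * (frob (⇑m) g : ℂ) ≠ 0 := by
    convert hm using 1
    simp only [Ψ, Finset.mul_sum, MvPolynomial.coeff_sum]
    refine Finset.sum_congr rfl fun g _ => ?_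
    rw [mul_left_comm, MvPolynomial.coeff_C_mul, ← map_mul, MvPolynomial.coeff_map]
    congr 2
    rw [frob]
    congr 1
    ext
    rfl
  obtain ⟨g, -, hg⟩ := Finset.exists_ne_zero_of_sum_ne_zero hm'
  have hg' : frob (⇑m) g ≠ 0 := fun h0 => hg (by rw [h0]; simp)
  obtain ⟨w, hw⟩ := exists_strictMono_of_frob_ne_zero _ g hg'
  have hsum : ∑ j, (⇑m ∘ w) j = n + ∑ j : Fin (K + 1), (j : ℕ) := by
    rw [← sum_content_of_frob_ne_zero _ g hg']
    exact Equiv.sum_comp w m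
  obtain ⟨y, hy⟩ := exists_irrChar_eq_frob hw hsum
  have hxy : x = y := by
    by_contra hne
    have h1 := sum_irrChar_mul_irrChar x y
    rw [if_neg hne] at h1
    apply hm'
    simp only [hy, frob_inv, frob_comp_perm, Int.cast_mul] at h1
    have h2 : ((Equiv.Perm.sign w : ℤ) : ℂ) ≠ 0 := by simp
    rw [← mul_right_inj' h2, mul_zero, Finset.mul_sum, ← h1]
    exact Finset.sum_congr rfl fun g _ => by ring
  exact ⟨⇑m ∘ w, hw, hsum, hxy ▸ hy⟩

theorem irrChar_injective {G : Type} [Group G] [Fintype G] {x y : Irr G}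
    (h : ∀ g, irrChar x g = irrChar y g) : x = y := by
  classical
  by_contra hne
  have h1 := sum_irrChar_mul_irrChar x y
  have h2 := sum_irrChar_mul_irrChar y y
  simp only [h] at h1
  rw [h1, if_neg hne, if_pos rfl] at h2
  exact Nat.cast_ne_zero.2 Fintype.card_ne_zero h2.symm

/-- The least size of a set whose pointwise stabiliser has a nonzero fixed vector. -/
def IsDepth {n : ℕ} (x : Irr (Equiv.Perm (Fin n))) (b : ℕ) : Prop :=
  HasFixed x b ∧ ∀ c < b, ¬ HasFixed x c

theorem exists_isDepth_le {n b : ℕ} {x : Irr (Equiv.Perm (Fin n))} (h : HasFixed x b) :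
    ∃ c ≤ b, IsDepth x c := by
  classical
  exact ⟨Nat.find ⟨b, h⟩, Nat.find_min' _ h, Nat.find_spec ⟨b, h⟩, fun _ hc => Nat.find_min _ hc⟩

theorem IsDepth.unique {n b c : ℕ} {x : Irr (Equiv.Perm (Fin n))} (h : IsDepth x b)
    (h' : IsDepth x c) : b = c :=
  le_antisymm (not_lt.1 fun hlt => h.2 c hlt h'.1) (not_lt.1 fun hlt => h'.2 b hlt h.1)

/-! ### Partitions of the depth, hook products and dimensions. -/

/-- Beta-sets of the partitions of `b` with `b` (possibly zero) parts. -/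
noncomputable def shapes (b : ℕ) : Finset (Fin b → ℕ) := by
  classical
  exact (Fintype.piFinset fun _ => range (2 * b)).filter fun L =>
    StrictMono L ∧ ∑ j, L j = b + ∑ j : Fin b, (j : ℕ)

theorem lt_of_sum_eq {b : ℕ} {L : Fin b → ℕ} (hL : StrictMono L)
    (hsum : ∑ j, L j = b + ∑ j : Fin b, (j : ℕ)) (j : Fin b) : L j < 2 * b := by
  have hle : ∀ i : Fin b, (i : ℕ) ≤ L i := by
    rintro ⟨m, hm⟩
    induction m with
    | zero => exact Nat.zero_le _
    | succ m ih => exact (ih (by omega)).trans_lt (hL (Fin.mk_lt_mk.2 m.lt_succ_self))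
  have h1 := Finset.add_sum_erase univ L (Finset.mem_univ j)
  have h2 := Finset.add_sum_erase univ (fun i : Fin b => (i : ℕ)) (Finset.mem_univ j)
  have h3 : ∑ i ∈ univ.erase j, (i : ℕ) ≤ ∑ i ∈ univ.erase j, L i :=
    Finset.sum_le_sum fun i _ => hle i
  have := j.isLt
  omega

theorem mem_shapes {b : ℕ} {L : Fin b → ℕ} :
    L ∈ shapes b ↔ StrictMono L ∧ ∑ j, L j = b + ∑ j : Fin b, (j : ℕ) := by
  simp only [shapes, Finset.mem_filter, Fintype.mem_piFinset, Finset.mem_range, and_iff_right_iff_imp]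
  exact fun h => lt_of_sum_eq h.1 h.2

/-- A beta-set is determined by its image, a subset of {0, …, 2b − 1}. -/
theorem card_shapes_le (b : ℕ) : (shapes b).card ≤ 4 ^ b := by
  have : Set.InjOn (fun L : Fin b → ℕ => univ.image L) (shapes b) := by
    intro L hL L' hL' h
    have h1 := (mem_shapes.1 hL).1
    have h2 := (mem_shapes.1 hL').1
    refine (h1.range_inj h2).1 ?_
    simpa using congrArg (fun s : Finset ℕ => (s : Set ℕ)) h
  calc (shapes b).card ≤ (range (2 * b)).powerset.card := by
        refine Finset.card_le_card_of_injOn _ (fun L hL => ?_) this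
        rw [Finset.mem_coe, Finset.mem_powerset]
        intro i hi
        obtain ⟨j, -, rfl⟩ := Finset.mem_image.1 hi
        obtain ⟨h1, h2⟩ := mem_shapes.1 hL
        exact Finset.mem_range.2 (lt_of_sum_eq h1 h2 j)
    _ = 4 ^ b := by
        rw [Finset.card_powerset, Finset.card_range, pow_mul]
        norm_num

/-- For fixed j the differences `L j - L i` with i < j are distinct integers in [1, `L j`], so their
product divides the factorial. This makes the division in `hookProd` exact. -/
theorem det_vandermonde_dvd {b : ℕ} {L : Fin b → ℕ} (hL : StrictMono L) :
    (Matrix.vandermonde fun j => (L j : ℤ)).det ∣ ∏ j, ((L j).factorial : ℤ) := by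
  classical
  have h : (Matrix.vandermonde fun j => (L j : ℤ)).det =
      ∏ j : Fin b, ∏ i ∈ Finset.Iio j, ((L j : ℤ) - L i) := by
    rw [Matrix.det_vandermonde]
    exact Finset.prod_comm' (by simp)
  rw [h]
  refine Finset.prod_dvd_prod_of_dvd _ _ fun j _ => ?_
  have h1 : ∏ i ∈ Finset.Iio j, ((L j : ℤ) - L i) = ((∏ i ∈ Finset.Iio j, (L j - L i) : ℕ) : ℤ) := by
    push_cast
    refine Finset.prod_congr rfl fun i hi => ?_
    rw [Nat.cast_sub (hL (Finset.mem_Iio.1 hi)).le]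
  rw [h1, Int.natCast_dvd_natCast, ← Finset.prod_Ico_id_eq_factorial]
  have h2 : ∏ i ∈ Finset.Iio j, (L j - L i) = ∏ m ∈ (Finset.Iio j).image fun i => L j - L i, m := by
    rw [Finset.prod_image]
    intro a ha c hc hac
    have h3 := hL (Finset.mem_Iio.1 ha)
    have h4 := hL (Finset.mem_Iio.1 hc)
    exact hL.injective (by simp only at hac; omega)
  rw [h2]
  refine Finset.prod_dvd_prod_of_subset _ _ _ fun m hm => ?_
  obtain ⟨i, hi, rfl⟩ := Finset.mem_image.1 hm
  have h3 := hL (Finset.mem_Iio.1 hi)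
  rw [Finset.mem_Ico]
  omega

/-- The product of the hook lengths of the shape with beta-set `L`. -/
noncomputable def hookProd {b : ℕ} (L : Fin b → ℕ) : ℕ :=
  ((∏ j, ((L j).factorial : ℤ)) / (Matrix.vandermonde fun j => (L j : ℤ)).det).toNat

theorem hookProd_mul {b : ℕ} {L : Fin b → ℕ} (hL : StrictMono L) :
    (hookProd L : ℤ) * (Matrix.vandermonde fun j => (L j : ℤ)).det = ∏ j, ((L j).factorial : ℤ) := by
  have h := det_vandermonde_pos hL
  rw [hookProd, Int.toNat_of_nonneg, Int.ediv_mul_cancel (det_vandermonde_dvd hL)]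
  exact Int.ediv_nonneg (Finset.prod_nonneg fun _ _ => by positivity) h.le

theorem hookProd_pos {b : ℕ} {L : Fin b → ℕ} (hL : StrictMono L) : 0 < hookProd L := by
  have h := hookProd_mul hL
  have h1 : 0 < ∏ j, ((L j).factorial : ℤ) :=
    Finset.prod_pos fun j _ => by exact_mod_cast (L j).factorial_pos
  rw [← h] at h1
  exact_mod_cast pos_of_mul_pos_left h1 (det_vandermonde_pos hL).le

/-- The quotient of b! by the hook product is the degree `frob L 1` in S_b, a positive integer. -/
theorem hookProd_le {b : ℕ} {L : Fin b → ℕ} (hL : L ∈ shapes b) : hookProd L ≤ b.factorial := by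
  obtain ⟨h1, h2⟩ := mem_shapes.1 hL
  have h3 := prod_factorial_mul_frob_one (n := b) L h2
  have h4 : 0 < frob L (1 : Equiv.Perm (Fin b)) := frob_one_pos h1 h2
  have h5 := det_vandermonde_pos h1
  rw [← hookProd_mul h1] at h3
  have h6 : (hookProd L : ℤ) * frob L (1 : Equiv.Perm (Fin b)) = b.factorial :=
    mul_right_cancel₀ h5.ne' (by rw [← h3]; ring)
  have h7 : (hookProd L : ℤ) ≤ b.factorial := by
    rw [← h6]
    exact le_mul_of_one_le_right (by positivity) h4
  exact_mod_cast h7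

theorem det_vandermonde_snoc {b : ℕ} (L : Fin b → ℤ) (m : ℤ) :
    (Matrix.vandermonde (Fin.snoc L m : Fin (b + 1) → ℤ)).det =
      (Matrix.vandermonde L).det * ∏ j, (m - L j) := by
  have h : ∀ (c : ℕ) (v : Fin c → ℤ), (Matrix.vandermonde v).det =
      ∏ i, ∏ j, if i < j then v j - v i else 1 := by
    intro c v
    rw [Matrix.det_vandermonde]
    refine Finset.prod_congr rfl fun i _ => ?_
    rw [← Finset.prod_filter]
    congr 1
    ext j
    simp
  rw [h, h]
  simp only [Fin.prod_univ_castSucc, Fin.snoc_castSucc, Fin.snoc_last, Fin.castSucc_lt_castSucc_iff,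
    Fin.castSucc_lt_last, if_true, Finset.prod_mul_distrib, lt_irrefl, if_false,
    (Fin.castSucc_lt_last _).not_gt, Finset.prod_const_one, mul_one]

theorem snoc_strictMono {b n : ℕ} {L : Fin b → ℕ} (hL : StrictMono L) (hn : ∀ j, L j < n) :
    StrictMono (Fin.snoc L n : Fin (b + 1) → ℕ) := by
  intro i j hij
  induction j using Fin.lastCases with
  | last =>
    induction i using Fin.lastCases with
    | last => exact absurd hij (lt_irrefl _)
    | cast i => simpa using hn i
  | cast j =>
    induction i using Fin.lastCases with
    | last => exact absurd hij (Fin.castSucc_lt_last j).not_gt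
    | cast i => simpa using hL (Fin.castSucc_lt_castSucc_iff.1 hij)

theorem sum_snoc {b n : ℕ} {L : Fin b → ℕ} (hL : ∑ j, L j = b + ∑ j : Fin b, (j : ℕ)) :
    ∑ j, (Fin.snoc L n : Fin (b + 1) → ℕ) j = n + ∑ j : Fin (b + 1), (j : ℕ) := by
  simp only [Fin.sum_univ_castSucc, Fin.snoc_castSucc, Fin.snoc_last, hL, Fin.val_castSucc, Fin.val_last]
  ring

/-- Putting a first row of length n − b on top of a partition of b appends n − b + b = n to its
beta-set. The bound 2b ≤ n puts n above every other entry. -/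
theorem isDepth_iff {n b : ℕ} (hn : 2 * b ≤ n) (x : Irr (Equiv.Perm (Fin n))) :
    IsDepth x b ↔ ∃ L ∈ shapes b, ∀ g,
      irrChar x g = frob (Fin.snoc L n : Fin (b + 1) → ℕ) g := by
  constructor
  · rintro ⟨h1, h2⟩
    obtain ⟨l, hl, hsum, hx⟩ := h1.exists_eq_frob le_rfl
    have h3 := h1.le_of_eq_frob hl hsum hx le_rfl
    have h4 := hasFixed_of_eq_frob hl hsum hx
    have h5 : l (Fin.last b) = n := by
      have := not_lt.1 fun hlt => h2 _ hlt h4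
      -- For b = 0 truncated subtraction makes the lower bound on the depth vacuous; the sum
      -- condition settles that case.
      rcases Nat.eq_zero_or_pos b with rfl | hb
      · simpa using hsum
      · omega
    have hl' : l = Fin.snoc (fun j : Fin b => l j.castSucc) n := by
      rw [← h5]; exact (Fin.snoc_init_self l).symm
    refine ⟨fun j => l j.castSucc, mem_shapes.2 ⟨hl.comp Fin.strictMono_castSucc, ?_⟩, ?_⟩
    · simp only [Fin.sum_univ_castSucc, h5, Fin.val_castSucc, Fin.val_last] at hsum
      omega
    · rw [← hl']; exact hx
  · rintro ⟨L, hL, hx⟩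
    obtain ⟨h1, h2⟩ := mem_shapes.1 hL
    have hl := snoc_strictMono h1 fun j => (lt_of_sum_eq h1 h2 j).trans_le hn
    have hsum := sum_snoc (n := n) h2
    constructor
    · have := hasFixed_of_eq_frob hl hsum hx
      rw [Fin.snoc_last] at this
      rwa [show n - (n - b) = b by omega] at this
    · intro c hc h
      have := h.le_of_eq_frob hl hsum hx hc.le
      rw [Fin.snoc_last] at this
      omega

theorem exists_irr_of_shape {n b : ℕ} (hn : 2 * b ≤ n) {L : Fin b → ℕ} (hL : L ∈ shapes b) :
    ∃ x : Irr (Equiv.Perm (Fin n)), ∀ g, irrChar x g = frob (Fin.snoc L n : Fin (b + 1) → ℕ) g := by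
  obtain ⟨h1, h2⟩ := mem_shapes.1 hL
  exact exists_irrChar_eq_frob (snoc_strictMono h1 fun j => (lt_of_sum_eq h1 h2 j).trans_le hn)
    (sum_snoc h2)

theorem hookProd_mul_dim {n b : ℕ} {L : Fin b → ℕ} (hL : L ∈ shapes b)
    {x : Irr (Equiv.Perm (Fin n))} (hx : ∀ g, irrChar x g = frob (Fin.snoc L n : Fin (b + 1) → ℕ) g) :
    (hookProd L : ℤ) * x.dim = ∏ j, ((n : ℤ) - L j) := by
  obtain ⟨h1, h2⟩ := mem_shapes.1 hL
  have h3 := prod_factorial_mul_frob_one (Fin.snoc L n : Fin (b + 1) → ℕ) (sum_snoc (n := n) h2)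
  have h4 : (x.dim : ℤ) = frob (Fin.snoc L n : Fin (b + 1) → ℕ) (1 : Equiv.Perm (Fin n)) := by
    have := hx 1
    rw [irrChar_one] at this
    exact_mod_cast this
  have h5 : (fun j => (((Fin.snoc L n : Fin (b + 1) → ℕ) j : ℕ) : ℤ)) =
      Fin.snoc (fun j => (L j : ℤ)) (n : ℤ) := by
    funext j
    induction j using Fin.lastCases <;> simp
  rw [← h4, h5, det_vandermonde_snoc, Fin.prod_univ_castSucc] at h3
  simp only [Fin.snoc_castSucc, Fin.snoc_last] at h3
  rw [← hookProd_mul h1] at h3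
  have h6 := (det_vandermonde_pos h1).ne'
  have h7 : (n.factorial : ℤ) ≠ 0 := by exact_mod_cast n.factorial_ne_zero
  apply mul_left_cancel₀ (mul_ne_zero h6 h7)
  linear_combination h3

/-- `F` is left free: the main terms use the power −s, the tail estimate the power −1. -/
theorem sum_isDepth {n b : ℕ} (hn : 2 * b ≤ n) (s : Finset (Irr (Equiv.Perm (Fin n))))
    (hs : ∀ x, x ∈ s ↔ IsDepth x b) (F : ℝ → ℝ) :
    ∑ x ∈ s, F x.dim = ∑ L ∈ shapes b, F ((∏ j, ((n : ℝ) - L j)) / hookProd L) := by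
  classical
  choose y hy using fun (L : Fin b → ℕ) (hL : L ∈ shapes b) => exists_irr_of_shape hn hL
  symm
  refine Finset.sum_bij y ?_ ?_ ?_ ?_
  · intro L hL
    exact (hs _).2 ((isDepth_iff hn _).2 ⟨L, hL, hy L hL⟩)
  · intro L hL L' hL' h
    obtain ⟨h1, h2⟩ := mem_shapes.1 hL
    obtain ⟨h1', h2'⟩ := mem_shapes.1 hL'
    have hl := snoc_strictMono h1 fun j => (lt_of_sum_eq h1 h2 j).trans_le hn
    have hl' := snoc_strictMono h1' fun j => (lt_of_sum_eq h1' h2' j).trans_le hn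
    have heq : ∀ g : Equiv.Perm (Fin n), frob (Fin.snoc L n : Fin (b + 1) → ℕ) g =
        frob (Fin.snoc L' n : Fin (b + 1) → ℕ) g := fun g => by
      have := (hy L hL g).symm.trans ((congrArg (fun z => irrChar z g) h).trans (hy L' hL' g))
      exact_mod_cast this
    by_contra hne
    have h3 := sum_frob_mul_frob hl hl' (sum_snoc (n := n) h2')
    have h4 := sum_frob_mul_frob hl' hl' (sum_snoc (n := n) h2')
    have hne' : (Fin.snoc L n : Fin (b + 1) → ℕ) ≠ Fin.snoc L' n := fun h => hne (by
      have := congrArg Fin.init h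
      simpa using this)
    simp only [heq] at h3
    rw [h3, if_neg hne', if_pos rfl] at h4
    exact n.factorial_ne_zero (by exact_mod_cast h4.symm)
  · intro x hx
    obtain ⟨L, hL, hxL⟩ := (isDepth_iff hn x).1 ((hs x).1 hx)
    exact ⟨L, hL, irrChar_injective fun g => by rw [hy L hL, hxL]⟩
  · intro L hL
    have h1 := hookProd_mul_dim hL (hy L hL)
    have h2 : (hookProd L : ℝ) ≠ 0 := by
      exact_mod_cast (hookProd_pos (mem_shapes.1 hL).1).ne'
    congr 1
    rw [div_eq_iff h2, mul_comm]
    exact_mod_cast h1.symm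

/-! ### Tensoring with the sign. -/

/-- The sign character with complex values. -/
def signC {n : ℕ} (g : Equiv.Perm (Fin n)) : ℂ := ((Equiv.Perm.sign g : ℤ) : ℂ)

theorem signC_one {n : ℕ} : signC (1 : Equiv.Perm (Fin n)) = 1 := by simp [signC]

theorem signC_mul {n : ℕ} (g h : Equiv.Perm (Fin n)) : signC (g * h) = signC g * signC h := by
  simp [signC]

theorem signC_mul_self {n : ℕ} (g : Equiv.Perm (Fin n)) : signC g * signC g = 1 := by
  rcases Int.units_eq_one_or (Equiv.Perm.sign g) with h | h <;> simp [signC, h]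

/-- The tensor product of a representation with the sign character. -/
noncomputable def signTwist {n : ℕ} {V : Type} [AddCommGroup V] [Module ℂ V]
    (ρ : Representation ℂ (Equiv.Perm (Fin n)) V) : Representation ℂ (Equiv.Perm (Fin n)) V where
  toFun g := signC g • ρ g
  map_one' := by simp [signC_one]
  map_mul' g h := by
    refine LinearMap.ext fun v => ?_
    change signC (g * h) • ρ (g * h) v = signC g • ρ g (signC h • ρ h v)
    rw [signC_mul, map_mul, map_smul, smul_smul]
    rfl

theorem signTwist_apply {n : ℕ} {V : Type} [AddCommGroup V] [Module ℂ V]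
    (ρ : Representation ℂ (Equiv.Perm (Fin n)) V) (g : Equiv.Perm (Fin n)) (v : V) :
    signTwist ρ g v = signC g • ρ g v := rfl

theorem signTwist_isIrreducible {n : ℕ} {V : Type} [AddCommGroup V] [Module ℂ V]
    (ρ : Representation ℂ (Equiv.Perm (Fin n)) V) (h : ρ.IsIrreducible) :
    (signTwist ρ).IsIrreducible := by
  let F : Subrepresentation ρ ≃o Subrepresentation (signTwist ρ) :=
    { toFun := fun U => ⟨U.toSubmodule, fun g v hv =>
        U.toSubmodule.smul_mem _ (U.apply_mem_toSubmodule g hv)⟩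
      invFun := fun U => ⟨U.toSubmodule, fun g v hv => by
        have := U.toSubmodule.smul_mem (signC g) (U.apply_mem_toSubmodule g hv)
        rwa [signTwist_apply, smul_smul, signC_mul_self, one_smul] at this⟩
      left_inv := fun _ => rfl
      right_inv := fun _ => rfl
      map_rel_iff' := Iff.rfl }
  exact F.symm.isSimpleOrder_iff.2 h

/-- Tensoring with the sign character, on isomorphism classes. -/
noncomputable def twist {n : ℕ} (x : Irr (Equiv.Perm (Fin n))) : Irr (Equiv.Perm (Fin n)) :=
  (exists_irr _ (signTwist_isIrreducible x.out.rep x.out.irreducible)).choose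

theorem twist_equiv {n : ℕ} (x : Irr (Equiv.Perm (Fin n))) :
    Nonempty ((signTwist x.out.rep).Equiv (twist x).out.rep) :=
  (exists_irr _ (signTwist_isIrreducible x.out.rep x.out.irreducible)).choose_spec.1

theorem irrChar_twist {n : ℕ} (x : Irr (Equiv.Perm (Fin n))) (g : Equiv.Perm (Fin n)) :
    irrChar (twist x) g = signC g * irrChar x g := by
  have h := (exists_irr _ (signTwist_isIrreducible x.out.rep x.out.irreducible)).choose_spec.2 g
  refine h.trans ?_
  have : signTwist x.out.rep g = signC g • x.out.rep g := rfl
  rw [Representation.character, this, map_smul, smul_eq_mul]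
  rfl

theorem twist_twist {n : ℕ} (x : Irr (Equiv.Perm (Fin n))) : twist (twist x) = x :=
  irrChar_injective fun g => by
    rw [irrChar_twist, irrChar_twist, ← mul_assoc, signC_mul_self, one_mul]

theorem dim_twist {n : ℕ} (x : Irr (Equiv.Perm (Fin n))) : (twist x).dim = x.dim := by
  have h := irrChar_twist x 1
  rw [irrChar_one, irrChar_one, signC_one, one_mul] at h
  exact_mod_cast h

theorem hasFixed_twist_iff {n b : ℕ} (x : Irr (Equiv.Perm (Fin n))) :
    HasFixed (twist x) b ↔ ∃ B : Finset (Fin n), #B = b ∧ ∃ v ≠ 0, ∀ g : Equiv.Perm (Fin n),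
      (∀ i ∈ B, g i = i) → x.out.rep g v = signC g • v := by
  obtain ⟨e⟩ := twist_equiv x
  have he : ∀ g v, e.toLinearEquiv (signC g • x.out.rep g v) =
      (twist x).out.rep g (e.toLinearEquiv v) := fun g v =>
    Representation.IntertwiningMap.isIntertwining _ _ e.toIntertwiningMap g v
  have hiff : ∀ g v, x.out.rep g v = signC g • v ↔ signC g • x.out.rep g v = v := by
    intro g v
    constructor <;> intro h
    · rw [h, smul_smul, signC_mul_self, one_smul]
    · conv_rhs => rw [← h, smul_smul, signC_mul_self, one_smul]
  simp only [hiff]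
  constructor
  · rintro ⟨B, hB, v, hv0, hv⟩
    refine ⟨B, hB, e.toLinearEquiv.symm v, (LinearEquiv.map_ne_zero_iff _).2 hv0, fun g hg => ?_⟩
    apply e.toLinearEquiv.injective
    rw [he, LinearEquiv.apply_symm_apply, hv g hg]
  · rintro ⟨B, hB, v, hv0, hv⟩
    refine ⟨B, hB, e.toLinearEquiv v, (LinearEquiv.map_ne_zero_iff _).2 hv0, fun g hg => ?_⟩
    rw [← he, hv g hg]

/-- Let E be the antisymmetriser over the stabiliser of `C`. Any translate of `v` is fixed by a
transposition of two points outside `C` and the translate of `B`, so E kills it. By irreducibility E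
vanishes everywhere, yet it multiplies the sign-semiinvariant `w` by the order of the stabiliser. -/
theorem not_hasFixed_twist {n b c : ℕ} {x : Irr (Equiv.Perm (Fin n))} (h : HasFixed x b)
    (hbc : b + c + 2 ≤ n) : ¬ HasFixed (twist x) c := by
  classical
  rw [hasFixed_twist_iff]
  obtain ⟨B, hB, v, hv0, hv⟩ := h
  rintro ⟨C, hC, w, hw0, hw⟩
  let ρ := x.out.rep
  let S : Finset (Equiv.Perm (Fin n)) := {g | ∀ i ∈ C, g i = i}
  let E : (Fin x.out.dim → ℂ) →ₗ[ℂ] (Fin x.out.dim → ℂ) := ∑ g ∈ S, signC g • ρ g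
  have hEv : ∀ h, E (ρ h v) = 0 := by
    intro h
    have hcard : (C ∪ B.image h).card + 2 ≤ n := by
      have h1 := Finset.card_union_le C (B.image h)
      have h2 := Finset.card_image_le (s := B) (f := h)
      omega
    have h1 : 1 < (C ∪ B.image h)ᶜ.card := by
      rw [Finset.card_compl, Fintype.card_fin]; omega
    obtain ⟨p, hp, q, hq, hpq⟩ := Finset.one_lt_card.1 h1
    simp only [Finset.mem_compl, Finset.mem_union, Finset.mem_image, not_or, not_exists,
      not_and] at hp hq
    let t := Equiv.swap p q
    have ht : ρ t (ρ h v) = ρ h v := by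
      have h2 : ρ (h⁻¹ * t * h) v = v := hv _ fun i hi => by
        have hp' : h i ≠ p := hp.2 i hi
        have hq' : h i ≠ q := hq.2 i hi
        simp [t, Equiv.swap_apply_of_ne_of_ne hp' hq']
      conv_rhs => rw [← h2]
      rw [← Module.End.mul_apply, ← Module.End.mul_apply, ← map_mul, ← map_mul]
      congr 2
      group
    have htC : ∀ i ∈ C, t i = i := fun i hi =>
      Equiv.swap_apply_of_ne_of_ne (fun h => hp.1 (h ▸ hi)) (fun h => hq.1 (h ▸ hi))
    have h3 : ∀ u, E (ρ t u) = - E u := by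
      intro u
      simp only [E, LinearMap.sum_apply, LinearMap.smul_apply]
      rw [← Finset.sum_neg_distrib]
      refine Finset.sum_bij' (fun g _ => g * t) (fun g _ => g * t) ?_ ?_ ?_ ?_ ?_
      · intro g hg
        simp only [S, mem_filter, mem_univ, true_and] at hg ⊢
        intro i hi
        rw [Equiv.Perm.mul_apply, htC i hi, hg i hi]
      · intro g hg
        simp only [S, mem_filter, mem_univ, true_and] at hg ⊢
        intro i hi
        rw [Equiv.Perm.mul_apply, htC i hi, hg i hi]
      · intro g _
        simp [t, mul_assoc]
      · intro g _
        simp [t, mul_assoc]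
      · intro g _
        have : signC t = -1 := by simp [signC, t, Equiv.Perm.sign_swap hpq]
        rw [signC_mul, this, map_mul]
        simp
    have h4 := h3 (ρ h v)
    rw [ht] at h4
    exact self_eq_neg.1 h4
  let U : Subrepresentation ρ :=
    { toSubmodule := ⨅ h, LinearMap.ker (E ∘ₗ ρ h)
      apply_mem_toSubmodule := by
        intro g u hu
        simp only [Submodule.mem_iInf, LinearMap.mem_ker, LinearMap.comp_apply] at hu ⊢
        intro h
        have := hu (h * g)
        rw [map_mul] at this
        exact this }
  have hirr := x.out.irreducible
  have hU : U = ⊤ := by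
    refine (hirr.eq_bot_or_eq_top U).resolve_left fun hbot => hv0 ?_
    have hmem : v ∈ U.toSubmodule := by
      simp only [U, Submodule.mem_iInf, LinearMap.mem_ker, LinearMap.comp_apply]
      exact hEv
    rw [hbot] at hmem
    exact (Submodule.mem_bot ℂ).1 hmem
  have hwU : w ∈ U.toSubmodule := by
    rw [hU]; exact Submodule.mem_top
  simp only [U, Submodule.mem_iInf, LinearMap.mem_ker, LinearMap.comp_apply] at hwU
  have h5 := hwU 1
  simp only [map_one, Module.End.one_apply, E, LinearMap.sum_apply, LinearMap.smul_apply] at h5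
  rw [Finset.sum_congr rfl (g := fun _ => w)] at h5
  · rw [Finset.sum_const, ← Nat.cast_smul_eq_nsmul ℂ, smul_eq_zero, Nat.cast_eq_zero,
      Finset.card_eq_zero] at h5
    refine h5.elim (fun h => ?_) hw0
    have : (1 : Equiv.Perm (Fin n)) ∈ S := by simp [S]
    rw [h] at this
    exact absurd this (Finset.notMem_empty _)
  · intro g hg
    simp only [S, mem_filter, mem_univ, true_and] at hg
    rw [hw g hg, smul_smul, signC_mul_self, one_smul]

/-! ### Depth is logarithmic in the dimension. -/

section Restriction

variable {n : ℕ} {V : Type} [AddCommGroup V] [Module ℂ V]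
  (ρ : Representation ℂ (Equiv.Perm (Fin n)) V)

/-- The subspace `W` is stable under the pointwise stabiliser of `B`. -/
def StableUnder (B : Finset (Fin n)) (W : Submodule ℂ V) : Prop :=
  ∀ g : Equiv.Perm (Fin n), (∀ i ∈ B, g i = i) → ∀ w ∈ W, ρ g w ∈ W

theorem StableUnder.exists_compl {B : Finset (Fin n)} {U W : Submodule ℂ V}
    (hU : StableUnder ρ B U) (hW : StableUnder ρ B W) (hUW : U ≤ W) :
    ∃ U' ≤ W, StableUnder ρ B U' ∧ U ⊓ U' = ⊥ ∧ U ⊔ U' = W := by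
  let H : Subgroup (Equiv.Perm (Fin n)) :=
    { carrier := {g | ∀ i ∈ B, g i = i}
      one_mem' := by simp
      mul_mem' := by
        intro a b ha hb i hi
        rw [Equiv.Perm.mul_apply, hb i hi, ha i hi]
      inv_mem' := by
        intro a ha i hi
        rw [Equiv.Perm.inv_eq_iff_eq]
        exact (ha i hi).symm }
  let τ : Representation ℂ H V := ρ.comp H.subtype
  let U₁ : Subrepresentation τ := ⟨U, fun g v hv => hU g.1 g.2 v hv⟩
  obtain ⟨U₂, h⟩ := exists_isCompl U₁
  have h1 : IsCompl U U₂.toSubmodule := by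
    constructor
    · rw [disjoint_iff]
      exact congrArg Subrepresentation.toSubmodule h.inf_eq_bot
    · rw [codisjoint_iff]
      exact congrArg Subrepresentation.toSubmodule h.sup_eq_top
  refine ⟨U₂.toSubmodule ⊓ W, inf_le_right, fun g hg w hw => ?_, ?_, ?_⟩
  · exact ⟨U₂.apply_mem_toSubmodule ⟨g, hg⟩ hw.1, hW g hg w hw.2⟩
  · rw [← inf_assoc, h1.inf_eq_bot, bot_inf_eq]
  · rw [← sup_inf_assoc_of_le _ hUW, h1.sup_eq_top, top_inf_eq]

/-- If `W` has no proper subspace stable under the smaller stabiliser of `B ∪ {a, b}`, then the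
stabiliser of `B` acts on `W` trivially or by the sign. -/
theorem StableUnder.trivial_or_sign {B : Finset (Fin n)} {W : Submodule ℂ V}
    (hW : StableUnder ρ B W) {a b : Fin n} (ha : a ∉ B) (hb : b ∉ B) (hab : a ≠ b)
    (hmin : ∀ U ≤ W, StableUnder ρ (insert a (insert b B)) U → U = ⊥ ∨ U = W) :
    (∀ g : Equiv.Perm (Fin n), (∀ i ∈ B, g i = i) → ∀ w ∈ W, ρ g w = w) ∨
    (∀ g : Equiv.Perm (Fin n), (∀ i ∈ B, g i = i) → ∀ w ∈ W, ρ g w = signC g • w) := by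
  classical
  let t := Equiv.swap a b
  have htB : ∀ i ∈ B, t i = i := fun i hi =>
    Equiv.swap_apply_of_ne_of_ne (fun h => ha (h ▸ hi)) (fun h => hb (h ▸ hi))
  have htt : ∀ w, ρ t (ρ t w) = w := fun w => by
    rw [← Module.End.mul_apply, ← map_mul, Equiv.swap_mul_self, map_one, Module.End.one_apply]
  -- The smaller stabiliser commutes with t = (a b), so it preserves the t-fixed vectors. By
  -- minimality t acts on `W` as 1 or, since w + t w is t-fixed, as −1.
  let U : Submodule ℂ V := W ⊓ LinearMap.ker (ρ t - 1)
  have hUmem : ∀ w, w ∈ U ↔ w ∈ W ∧ ρ t w = w := fun w => by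
    simp [U, sub_eq_zero]
  have hU : StableUnder ρ (insert a (insert b B)) U := by
    intro g hg w hw
    rw [hUmem] at hw ⊢
    refine ⟨hW g (fun i hi => hg i (by simp [hi])) w hw.1, ?_⟩
    have hcomm : t * g = g * t := by
      have h1 : g * t = Equiv.swap (g a) (g b) * g := Equiv.mul_swap_eq_swap_mul g a b
      rw [h1, hg a (by simp), hg b (by simp)]
    rw [← Module.End.mul_apply, ← map_mul, hcomm, map_mul, Module.End.mul_apply, hw.2]
  -- extend from one transposition to the whole stabiliser
  have hext : ∀ (χ : Equiv.Perm (Fin n) → ℂ), χ 1 = 1 → (∀ g h, χ (g * h) = χ g * χ h) →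
      (∀ w ∈ W, ρ t w = χ t • w) →
      ∀ g : Equiv.Perm (Fin n), (∀ i ∈ B, g i = i) → ∀ w ∈ W, ρ g w = χ g • w := by
    intro χ hχ1 hχ ht g hg w hw
    let ι : Equiv.Perm {i // i ∉ B} →* Equiv.Perm (Fin n) := Equiv.Perm.ofSubtype
    have hι : ∀ σ : Equiv.Perm {i // i ∉ B}, ∀ i ∈ B, ι σ i = i := fun σ i hi =>
      Equiv.Perm.ofSubtype_apply_of_not_mem σ (by simpa using hi)
    have hιt : ι (Equiv.swap ⟨a, ha⟩ ⟨b, hb⟩) = t := Equiv.Perm.ofSubtype_swap_eq _ _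
    -- All transpositions off `B` are conjugate to t within the stabiliser of `B`, and they generate
    -- it.
    have key : ∀ σ : Equiv.Perm {i // i ∉ B}, ∀ w ∈ W, ρ (ι σ) w = χ (ι σ) • w := by
      intro σ
      induction σ using Equiv.Perm.swap_induction_on with
      | one => intro w _; simp [hχ1]
      | swap_mul σ p q hpq ih =>
        intro w hw
        obtain ⟨c, hc⟩ := isConj_iff.1 (Equiv.Perm.isConj_swap
          (show (⟨a, ha⟩ : {i // i ∉ B}) ≠ ⟨b, hb⟩ by simpa using hab) hpq)
        have hs : ∀ u ∈ W, ρ (ι (Equiv.swap p q)) u = χ (ι (Equiv.swap p q)) • u := by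
          intro u hu
          have hcu : ρ (ι c⁻¹) u ∈ W := hW _ (hι _) u hu
          have h1 : ρ (ι c * t * ι c⁻¹) u = ρ (ι c) (ρ t (ρ (ι c⁻¹) u)) := by
            rw [map_mul, map_mul]
            rfl
          have h2 : ρ (ι c) (ρ (ι c⁻¹) u) = u := by
            rw [← Module.End.mul_apply, ← map_mul, ← map_mul, mul_inv_cancel, map_one, map_one,
              Module.End.one_apply]
          have h3 : χ (ι c) * χ (ι c⁻¹) = 1 := by
            rw [← hχ, ← map_mul, mul_inv_cancel, map_one, hχ1]
          rw [← hc, map_mul ι, map_mul ι, hιt, h1, ht _ hcu, map_smul, h2, hχ, hχ]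
          congr 1
          linear_combination -(χ t) * h3
        rw [map_mul, map_mul, Module.End.mul_apply, ih w hw, map_smul, hs w hw, hχ, smul_smul,
          mul_comm]
    have hgι : ι (Equiv.Perm.subtypePerm g (p := fun i => i ∉ B) (fun i => by
        constructor
        · intro h hi
          exact h (by rwa [hg i hi])
        · intro h hi
          have := g.injective (hg (g i) hi)
          rw [this] at hi
          exact h hi)) = g := by
      apply Equiv.Perm.ofSubtype_subtypePerm
      intro i hi hiB
      exact hi (hg i hiB)
    rw [← hgι]
    exact key _ w hw
  rcases hmin U inf_le_left hU with h | h
  · right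
    refine hext signC signC_one signC_mul fun w hw => ?_
    have : w + ρ t w ∈ U := by
      rw [hUmem]
      exact ⟨W.add_mem hw (hW t htB w hw), by rw [map_add, htt, add_comm]⟩
    rw [h, Submodule.mem_bot] at this
    have hs : signC t = -1 := by simp [signC, t, Equiv.Perm.sign_swap hab]
    rw [hs, neg_one_smul]
    exact (neg_eq_of_add_eq_zero_right this).symm
  · left
    have := hext (fun _ => 1) rfl (fun _ _ => (one_mul 1).symm) fun w hw => by
      rw [one_smul]
      exact ((hUmem w).1 (h ▸ hw)).2
    simpa using this

/-- Fix two more points. Either `W` stays without proper stable subspaces and `trivial_or_sign`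
applies, or it splits and the smaller summand has at most half the dimension. Two points per halving
give the square of the dimension; with at most one point left the stabiliser is trivial. -/
theorem StableUnder.exists_semiinvariant [FiniteDimensional ℂ V] :
    ∀ (m : ℕ) (B : Finset (Fin n)) (W : Submodule ℂ V), n - #B ≤ m → StableUnder ρ B W → W ≠ ⊥ →
      ∃ C : Finset (Fin n), 2 ^ #C ≤ 2 ^ #B * Module.finrank ℂ W ^ 2 ∧ ∃ w ∈ W, w ≠ 0 ∧
        ((∀ g : Equiv.Perm (Fin n), (∀ i ∈ C, g i = i) → ρ g w = w) ∨
         (∀ g : Equiv.Perm (Fin n), (∀ i ∈ C, g i = i) → ρ g w = signC g • w)) := by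
  classical
  intro m
  induction m using Nat.strong_induction_on with
  | _ m ih =>
  intro B W hm hW hW0
  have hpos : ∀ U : Submodule ℂ V, U ≠ ⊥ → 0 < Module.finrank ℂ U := fun U hU =>
    Nat.pos_of_ne_zero fun h => hU (Submodule.finrank_eq_zero.1 h)
  have hself : 2 ^ #B ≤ 2 ^ #B * Module.finrank ℂ W ^ 2 :=
    Nat.le_mul_of_pos_right _ (pow_pos (hpos W hW0) 2)
  obtain ⟨w, hw, hw0⟩ := (Submodule.ne_bot_iff _).1 hW0
  by_cases hB : Bᶜ.card ≤ 1
  · refine ⟨B, hself, w, hw, hw0, Or.inl fun g hg => ?_⟩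
    have : g = 1 := by
      ext i
      by_cases hi : i ∈ B
      · simp [hg i hi]
      · have hgi : g i ∉ B := fun h => hi (by
          have := g.injective (hg (g i) h)
          rwa [this] at h)
        have := Finset.card_le_one.1 hB (g i) (by simpa using hgi) i (by simpa using hi)
        simp [this]
    simp [this]
  · obtain ⟨a, ha, b, hb, hab⟩ := Finset.one_lt_card.1 (not_le.1 hB)
    rw [Finset.mem_compl] at ha hb
    by_cases hmin : ∀ U ≤ W, StableUnder ρ (insert a (insert b B)) U → U = ⊥ ∨ U = W
    · refine ⟨B, hself, w, hw, hw0, ?_⟩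
      exact (hW.trivial_or_sign ρ ha hb hab hmin).imp (fun h g hg => h g hg w hw)
        (fun h g hg => h g hg w hw)
    · push Not at hmin
      obtain ⟨U, hUW, hU, hU0, hU1⟩ := hmin
      have hcard : #(insert a (insert b B)) = #B + 2 := by
        rw [Finset.card_insert_of_notMem (by simp [hab, ha]), Finset.card_insert_of_notMem hb]
      have hle : #B + 2 ≤ n := by
        rw [← hcard]
        simpa using Finset.card_le_univ (insert a (insert b B))
      have hW' : StableUnder ρ (insert a (insert b B)) W := fun g hg =>
        hW g fun i hi => hg i (by simp [hi])
      obtain ⟨U', hU'W, hU', hinf, hsup⟩ := hU.exists_compl ρ hW' hUW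
      have hU'0 : U' ≠ ⊥ := by
        rintro rfl
        rw [sup_bot_eq] at hsup
        exact hU1 hsup
      have hdim : Module.finrank ℂ U + Module.finrank ℂ U' = Module.finrank ℂ W := by
        have := Submodule.finrank_sup_add_finrank_inf_eq U U'
        rw [hinf, hsup, finrank_bot] at this
        omega
      have hstep : ∀ T : Submodule ℂ V, T ≤ W → StableUnder ρ (insert a (insert b B)) T → T ≠ ⊥ →
          2 * Module.finrank ℂ T ≤ Module.finrank ℂ W →
          ∃ C : Finset (Fin n), 2 ^ #C ≤ 2 ^ #B * Module.finrank ℂ W ^ 2 ∧ ∃ w ∈ W, w ≠ 0 ∧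
            ((∀ g : Equiv.Perm (Fin n), (∀ i ∈ C, g i = i) → ρ g w = w) ∨
             (∀ g : Equiv.Perm (Fin n), (∀ i ∈ C, g i = i) → ρ g w = signC g • w)) := by
        intro T hTW hT hT0 h2
        obtain ⟨C, hC, u, hu, hu0, h⟩ := ih (n - #(insert a (insert b B))) (by omega)
          (insert a (insert b B)) T le_rfl hT hT0
        refine ⟨C, hC.trans ?_, u, hTW hu, hu0, h⟩
        rw [hcard, pow_add, mul_assoc]
        refine Nat.mul_le_mul_left _ ?_
        calc 2 ^ 2 * Module.finrank ℂ T ^ 2 = (2 * Module.finrank ℂ T) ^ 2 := by ring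
          _ ≤ _ := Nat.pow_le_pow_left h2 2
      rcases le_total (Module.finrank ℂ U) (Module.finrank ℂ U') with h | h
      · exact hstep U hUW hU hU0 (by omega)
      · exact hstep U' hU'W hU' hU'0 (by omega)

end Restriction

theorem exists_hasFixed_or_twist {n : ℕ} (x : Irr (Equiv.Perm (Fin n))) :
    ∃ b, 2 ^ b ≤ x.dim ^ 2 ∧ (HasFixed x b ∨ HasFixed (twist x) b) := by
  have hx := dim_pos x
  rw [← dim_out] at hx ⊢
  have hfr : Module.finrank ℂ (⊤ : Submodule ℂ (Fin x.out.dim → ℂ)) = x.out.dim := by simp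
  obtain ⟨C, hC, w, -, hw0, h⟩ := StableUnder.exists_semiinvariant x.out.rep n ∅ ⊤ (by simp)
    (fun _ _ _ _ => Submodule.mem_top) (by
      intro h
      rw [h, finrank_bot] at hfr
      omega)
  rw [hfr, Finset.card_empty, pow_zero, one_mul] at hC
  exact ⟨#C, hC, h.imp (fun h => ⟨C, rfl, w, hw0, h⟩)
    (fun h => (hasFixed_twist_iff x).2 ⟨C, rfl, w, hw0, h⟩)⟩

/-! ### Counting irreducible representations. -/

theorem linearIndependent_irrChar (G : Type) [Group G] [Fintype G] :
    LinearIndependent ℂ (irrChar : Irr G → G → ℂ) := by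
  classical
  rw [Fintype.linearIndependent_iff]
  intro c hc x
  have h1 : ∑ g : G, (∑ y, c y • irrChar y) g * irrChar x g⁻¹ = 0 := by
    rw [hc]; simp
  simp only [Finset.sum_apply, Pi.smul_apply, smul_eq_mul, Finset.sum_mul, mul_assoc] at h1
  rw [Finset.sum_comm] at h1
  simp only [← Finset.mul_sum, sum_irrChar_mul_irrChar] at h1
  simpa using h1

theorem irrChar_conj {G : Type} [Group G] (x : Irr G) {g h : G} (hgh : IsConj g h) :
    irrChar x g = irrChar x h := by
  obtain ⟨c, rfl⟩ := isConj_iff.1 hgh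
  exact (x.out.rep.char_conj g c).symm

theorem card_irr_le (n : ℕ) :
    Fintype.card (Irr (Equiv.Perm (Fin n))) ≤ Fintype.card (Nat.Partition n) := by
  classical
  let π : Equiv.Perm (Fin n) → Nat.Partition (Fintype.card (Fin n)) := Equiv.Perm.partition
  let f : Irr (Equiv.Perm (Fin n)) → Nat.Partition (Fintype.card (Fin n)) → ℂ := fun x p =>
    if h : ∃ g, π g = p then irrChar x h.choose else 0
  have hf : ∀ x g, f x (π g) = irrChar x g := by
    intro x g
    have h : ∃ g', π g' = π g := ⟨g, rfl⟩
    simp only [f, dif_pos h]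
    exact irrChar_conj x (Equiv.Perm.partition_eq_of_isConj.2 h.choose_spec)
  have hli : LinearIndependent ℂ f := by
    refine LinearIndependent.of_comp (LinearMap.funLeft ℂ ℂ π) ?_
    convert linearIndependent_irrChar (Equiv.Perm (Fin n)) using 1
    funext x g
    exact hf x g
  have h := hli.fintype_card_le_finrank
  rw [Module.finrank_fintype_fun_eq_card] at h
  simpa using h

/-- Encode a partition by its multiplicities and compare with Euler's product ∏ 1/(1 − q^i). Each
factor is at most exp(q^i/(1 − q)), and these exponents sum to at most 1/(1 − q)². -/
theorem card_partition_mul_pow_le {q : ℝ} (h0 : 0 < q) (h1 : q < 1) (n : ℕ) :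
    Fintype.card (Nat.Partition n) * q ^ n ≤ Real.exp (1 / (1 - q) ^ 2) := by
  classical
  have hq : 0 < 1 - q := by linarith
  let cnt : Nat.Partition n → Fin n → ℕ := fun p i => p.parts.count ((i : ℕ) + 1)
  have hcnt_sum : ∀ p : Nat.Partition n, ∑ i : Fin n, ((i : ℕ) + 1) * cnt p i = n := by
    intro p
    have hsub : p.parts.toFinset ⊆ Finset.Ico 1 (n + 1) := by
      intro m hm
      have hm' := Multiset.mem_toFinset.1 hm
      have := p.parts_pos hm'
      have := Multiset.single_le_sum (fun _ _ => Nat.zero_le _) m hm'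
      rw [p.parts_sum] at this
      rw [Finset.mem_Ico]
      omega
    have h := Finset.sum_multiset_count_of_subset p.parts _ hsub
    rw [p.parts_sum, Finset.sum_Ico_eq_sum_range, Nat.add_sub_cancel] at h
    conv_rhs => rw [h]
    rw [← Fin.sum_univ_eq_sum_range (fun i => p.parts.count (1 + i) • (1 + i)) n]
    refine Finset.sum_congr rfl fun i _ => ?_
    simp [cnt, mul_comm, add_comm]
  have hcnt_inj : Function.Injective cnt := by
    intro p p' h
    apply Nat.Partition.ext
    ext m
    have hz : ∀ (r : Nat.Partition n) , (m = 0 ∨ n < m) → r.parts.count m = 0 := by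
      intro r hm
      rw [Multiset.count_eq_zero]
      intro hmem
      have := r.parts_pos hmem
      have := Multiset.single_le_sum (fun _ _ => Nat.zero_le _) m hmem
      rw [r.parts_sum] at this
      omega
    by_cases hm : m = 0 ∨ n < m
    · rw [hz p hm, hz p' hm]
    · have := congrFun h ⟨m - 1, by omega⟩
      simp only [cnt] at this
      rwa [show m - 1 + 1 = m by omega] at this
  have hmem : ∀ p : Nat.Partition n, cnt p ∈ Fintype.piFinset fun _ : Fin n => range (n + 1) := by
    intro p
    rw [Fintype.mem_piFinset]
    intro i
    rw [Finset.mem_range, Nat.lt_succ_iff]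
    calc cnt p i ≤ ((i : ℕ) + 1) * cnt p i := Nat.le_mul_of_pos_left _ (Nat.succ_pos _)
      _ ≤ ∑ i : Fin n, ((i : ℕ) + 1) * cnt p i :=
        Finset.single_le_sum (f := fun i : Fin n => ((i : ℕ) + 1) * cnt p i)
          (fun _ _ => Nat.zero_le _) (Finset.mem_univ i)
      _ = n := hcnt_sum p
  have hterm : ∀ p : Nat.Partition n, q ^ n = ∏ i : Fin n, (q ^ ((i : ℕ) + 1)) ^ cnt p i := by
    intro p
    conv_lhs => rw [← hcnt_sum p, ← Finset.prod_pow_eq_pow_sum]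
    exact Finset.prod_congr rfl fun i _ => pow_mul _ _ _
  have hfactor : ∀ i : Fin n, ∑ j ∈ range (n + 1), (q ^ ((i : ℕ) + 1)) ^ j ≤
      Real.exp (q ^ ((i : ℕ) + 1) / (1 - q)) := by
    intro i
    have hy0 : 0 < q ^ ((i : ℕ) + 1) := pow_pos h0 _
    have hyq : q ^ ((i : ℕ) + 1) ≤ q := by
      simpa using pow_le_pow_of_le_one h0.le h1.le (Nat.succ_pos i : 1 ≤ (i : ℕ) + 1)
    set y := q ^ ((i : ℕ) + 1)
    have h2 : ∑ j ∈ range (n + 1), y ^ j ≤ 1 / (1 - y) := by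
      rw [le_div_iff₀ (by linarith), geom_sum_mul_neg]
      linarith [pow_pos hy0 (n + 1)]
    have h3 : 1 / (1 - y) ≤ y / (1 - q) + 1 := by
      have h4 : y / (1 - y) ≤ y / (1 - q) := by gcongr
      have h5 : 1 / (1 - y) = y / (1 - y) + 1 := by
        have : (1 - y) ≠ 0 := by linarith
        field_simp
        ring
      linarith
    exact h2.trans (h3.trans (Real.add_one_le_exp _))
  calc Fintype.card (Nat.Partition n) * q ^ n
      = ∑ p : Nat.Partition n, ∏ i : Fin n, (q ^ ((i : ℕ) + 1)) ^ cnt p i := by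
        rw [← Finset.sum_congr rfl fun p _ => hterm p]
        simp
    _ = ∑ c ∈ univ.image cnt, ∏ i : Fin n, (q ^ ((i : ℕ) + 1)) ^ c i := by
        rw [Finset.sum_image fun _ _ _ _ h => hcnt_inj h]
    _ ≤ ∑ c ∈ Fintype.piFinset fun _ : Fin n => range (n + 1),
          ∏ i : Fin n, (q ^ ((i : ℕ) + 1)) ^ c i := by
        refine Finset.sum_le_sum_of_subset_of_nonneg ?_ fun _ _ _ =>
          Finset.prod_nonneg fun _ _ => by positivity
        intro c hc
        obtain ⟨p, -, rfl⟩ := Finset.mem_image.1 hc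
        exact hmem p
    _ = ∏ i : Fin n, ∑ j ∈ range (n + 1), (q ^ ((i : ℕ) + 1)) ^ j :=
        (Finset.prod_univ_sum _ _).symm
    _ ≤ ∏ i : Fin n, Real.exp (q ^ ((i : ℕ) + 1) / (1 - q)) :=
        Finset.prod_le_prod (fun _ _ => Finset.sum_nonneg fun _ _ => by positivity)
          fun i _ => hfactor i
    _ = Real.exp (∑ i : Fin n, q ^ ((i : ℕ) + 1) / (1 - q)) := (Real.exp_sum _ _).symm
    _ ≤ Real.exp (1 / (1 - q) ^ 2) := by
        apply Real.exp_le_exp.2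
        rw [← Finset.sum_div, Fin.sum_univ_eq_sum_range (fun i => q ^ (i + 1)) n, pow_two,
          ← div_div]
        gcongr
        rw [le_div_iff₀ hq]
        simp only [pow_succ, ← Finset.sum_mul]
        have := geom_sum_mul_neg q n
        have h2 := pow_pos h0 n
        nlinarith

/-! ### Integral asymptotic expansions in 1/n. -/

/-- `f n = P(1/n) + O(n^{-M})` for every `M`, with `P` integral of constant coefficient `c`. -/
def HasExpansion (f : ℕ → ℝ) (c : ℤ) : Prop :=
  ∀ M : ℕ, ∃ P : ℤ[X], P.coeff 0 = c ∧
    (fun n : ℕ => f n - aeval ((n : ℝ)⁻¹) P) =O[atTop] fun n : ℕ => ((n : ℝ) ^ M)⁻¹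

theorem isBigO_aeval (P : ℤ[X]) :
    (fun n : ℕ => aeval ((n : ℝ)⁻¹) P) =O[atTop] fun _ : ℕ => (1 : ℝ) := by
  have h : Tendsto (fun n : ℕ => aeval ((n : ℝ)⁻¹) P) atTop (nhds (aeval (0 : ℝ) P)) :=
    (P.continuous_aeval.tendsto 0).comp tendsto_inv_atTop_nhds_zero_nat
  exact h.isBigO_one ℝ

theorem isBigO_pow_inv (M : ℕ) :
    (fun n : ℕ => ((n : ℝ) ^ M)⁻¹) =O[atTop] fun _ : ℕ => (1 : ℝ) := by
  refine IsBigO.of_bound 1 ?_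
  filter_upwards [eventually_ge_atTop 1] with n hn
  have : (1 : ℝ) ≤ (n : ℝ) ^ M := one_le_pow₀ (by exact_mod_cast hn)
  rw [Real.norm_of_nonneg (by positivity)]
  simpa using inv_le_one_of_one_le₀ this

theorem hasExpansion_const (c : ℤ) : HasExpansion (fun _ => (c : ℝ)) c := fun M =>
  ⟨Polynomial.C c, by simp, by simpa using isBigO_zero _ _⟩

theorem HasExpansion.add {f g : ℕ → ℝ} {c d : ℤ} (hf : HasExpansion f c) (hg : HasExpansion g d) :
    HasExpansion (fun n => f n + g n) (c + d) := fun M => by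
  obtain ⟨P, hP, hfP⟩ := hf M
  obtain ⟨Q, hQ, hgQ⟩ := hg M
  refine ⟨P + Q, by simp [hP, hQ], ?_⟩
  refine (hfP.add hgQ).congr_left fun n => ?_
  simp only [map_add]
  ring

theorem HasExpansion.mul {f g : ℕ → ℝ} {c d : ℤ} (hf : HasExpansion f c) (hg : HasExpansion g d) :
    HasExpansion (fun n => f n * g n) (c * d) := fun M => by
  obtain ⟨P, hP, hfP⟩ := hf M
  obtain ⟨Q, hQ, hgQ⟩ := hg M
  refine ⟨P * Q, by simp [hP, hQ, mul_coeff_zero], ?_⟩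
  have hg1 : g =O[atTop] fun _ : ℕ => (1 : ℝ) :=
    ((hgQ.trans (isBigO_pow_inv M)).add (isBigO_aeval Q)).congr_left fun n => by ring
  have h1 := hfP.mul hg1
  have h2 := (isBigO_aeval P).mul hgQ
  simp only [mul_one, one_mul] at h1 h2
  refine (h1.add h2).congr_left fun n => ?_
  simp only [map_mul]
  ring

theorem HasExpansion.sum {ι : Type*} (s : Finset ι) {f : ι → ℕ → ℝ} {c : ι → ℤ}
    (h : ∀ i ∈ s, HasExpansion (f i) (c i)) :
    HasExpansion (fun n => ∑ i ∈ s, f i n) (∑ i ∈ s, c i) := by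
  classical
  induction s using Finset.induction_on with
  | empty => simpa using hasExpansion_const 0
  | insert a s ha ih =>
    simp only [Finset.sum_insert ha]
    exact (h a (by simp)).add (ih fun i hi => h i (by simp [hi]))

theorem HasExpansion.prod {ι : Type*} (s : Finset ι) {f : ι → ℕ → ℝ} {c : ι → ℤ}
    (h : ∀ i ∈ s, HasExpansion (f i) (c i)) :
    HasExpansion (fun n => ∏ i ∈ s, f i n) (∏ i ∈ s, c i) := by
  classical
  induction s using Finset.induction_on with
  | empty => simpa using hasExpansion_const 1
  | insert a s ha ih =>
    simp only [Finset.prod_insert ha]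
    exact (h a (by simp)).mul (ih fun i hi => h i (by simp [hi]))

theorem HasExpansion.pow {f : ℕ → ℝ} {c : ℤ} (hf : HasExpansion f c) (m : ℕ) :
    HasExpansion (fun n => f n ^ m) (c ^ m) := by
  simpa using HasExpansion.prod (range m) (f := fun _ => f) (c := fun _ => c) fun _ _ => hf

/-- The truncated geometric series of n⁻¹ (1 − l/n)⁻¹, whose remainder is (l/n)^M (n − l)⁻¹. -/
theorem hasExpansion_inv_sub (l : ℕ) : HasExpansion (fun n => ((n : ℝ) - l)⁻¹) 0 := fun M => by
  refine ⟨X * ∑ i ∈ range M, (Polynomial.C (l : ℤ) * X) ^ i, by simp [mul_coeff_zero], ?_⟩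
  refine IsBigO.of_bound ((l : ℝ) ^ M) ?_
  filter_upwards [eventually_ge_atTop (l + 1)] with n hn
  have hn' : (l : ℝ) + 1 ≤ n := by exact_mod_cast hn
  have hn0 : (0 : ℝ) < n := by have := (Nat.cast_nonneg l : (0 : ℝ) ≤ l); linarith
  have hnl : (0 : ℝ) < n - l := by linarith
  have hgeom := geom_sum_mul_neg ((l : ℝ) * (n : ℝ)⁻¹) M
  have h1 : aeval ((n : ℝ)⁻¹) (X * ∑ i ∈ range M, (Polynomial.C (l : ℤ) * X) ^ i : ℤ[X]) =
      (n : ℝ)⁻¹ * ∑ i ∈ range M, ((l : ℝ) * (n : ℝ)⁻¹) ^ i := by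
    simp [map_sum]
  have h2 : ((n : ℝ) - l)⁻¹ - (n : ℝ)⁻¹ * ∑ i ∈ range M, ((l : ℝ) * (n : ℝ)⁻¹) ^ i =
      ((l : ℝ) * (n : ℝ)⁻¹) ^ M * ((n : ℝ) - l)⁻¹ := by
    have h3 : 1 - (l : ℝ) * (n : ℝ)⁻¹ = (n - l) * (n : ℝ)⁻¹ := by field_simp
    rw [h3] at hgeom
    have h4 : (n : ℝ)⁻¹ * ∑ i ∈ range M, ((l : ℝ) * (n : ℝ)⁻¹) ^ i =
        (1 - ((l : ℝ) * (n : ℝ)⁻¹) ^ M) * ((n : ℝ) - l)⁻¹ := by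
      rw [← hgeom]
      field_simp
    rw [h4]
    ring
  rw [h1, h2, mul_pow, inv_pow, Real.norm_of_nonneg (by positivity), Real.norm_of_nonneg (by positivity)]
  have h5 : ((n : ℝ) - l)⁻¹ ≤ 1 := inv_le_one_of_one_le₀ (by linarith)
  exact mul_le_of_le_one_right (by positivity) h5

/-- Truncation of an expansion. -/
theorem exists_degree_lt {f : ℕ → ℝ} {M : ℕ} (hM : 1 ≤ M) {P : ℤ[X]}
    (h : (fun n : ℕ => f n - aeval ((n : ℝ)⁻¹) P) =O[atTop] fun n : ℕ => ((n : ℝ) ^ M)⁻¹) :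
    ∃ Q : ℤ[X], Q.degree < (M : WithBot ℕ) ∧ Q.coeff 0 = P.coeff 0 ∧
      (fun n : ℕ => f n - aeval ((n : ℝ)⁻¹) Q) =O[atTop] fun n : ℕ => ((n : ℝ) ^ M)⁻¹ := by
  have hmon : (X ^ M : ℤ[X]).Monic := monic_X_pow M
  have hdiv := modByMonic_add_div P (X ^ M : ℤ[X])
  refine ⟨P %ₘ X ^ M, ?_, ?_, ?_⟩
  · simpa using degree_modByMonic_lt P hmon
  · conv_rhs => rw [← hdiv]
    have : M ≠ 0 := by omega
    simp [mul_coeff_zero, coeff_X_pow, this.symm]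
  · have h1 : (fun n : ℕ => ((n : ℝ) ^ M)⁻¹ * aeval ((n : ℝ)⁻¹) (P /ₘ X ^ M)) =O[atTop]
        fun n : ℕ => ((n : ℝ) ^ M)⁻¹ := by
      simpa using (isBigO_refl (fun n : ℕ => ((n : ℝ) ^ M)⁻¹) atTop).mul (isBigO_aeval (P /ₘ X ^ M))
    refine (h.add h1).congr_left fun n => ?_
    conv_lhs => rw [← hdiv]
    simp only [map_add, map_mul, map_pow, aeval_X, inv_pow]
    rw [hdiv]
    ring

/-- The reciprocal of a function with an expansion around `2`. -/
theorem exists_inv_expansion {f : ℕ → ℝ} {M : ℕ} (hM : 1 ≤ M) {P : ℤ[X]} (hP : P.coeff 0 = 1)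
    (h : (fun n : ℕ => f n - 2 * aeval ((n : ℝ)⁻¹) P) =O[atTop] fun n : ℕ => ((n : ℝ) ^ M)⁻¹) :
    ∃ Q : ℤ[X], Q.coeff 0 = 1 ∧
      (fun n : ℕ => 1 / f n - 1 / 2 * aeval ((n : ℝ)⁻¹) Q) =O[atTop]
        fun n : ℕ => ((n : ℝ) ^ M)⁻¹ := by
  obtain ⟨R, hR⟩ : ∃ R : ℤ[X], P = 1 - X * R := by
    have hd : (X : ℤ[X]) ∣ 1 - P := by
      rw [X_dvd_iff]
      simp [hP]
    obtain ⟨R, hR⟩ := hd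
    exact ⟨R, by rw [← hR]; ring⟩
  -- The inverse of P = 1 − XR modulo X^M. The error is then (2 − f Q)(2f)⁻¹, whose second factor is
  -- bounded because f tends to 2.
  let Q : ℤ[X] := ∑ i ∈ range M, (X * R) ^ i
  have hPQ : P * Q = 1 - X ^ M * R ^ M := by
    rw [hR, mul_neg_geom_sum, mul_pow]
  have hQ : Q.coeff 0 = 1 := by
    have h1 := congrArg (fun p => p.coeff 0) hPQ
    have : M ≠ 0 := by omega
    simpa [mul_coeff_zero, hP, coeff_X_pow, this.symm] using h1
  refine ⟨Q, hQ, ?_⟩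
  have hu : Tendsto (fun n : ℕ => ((n : ℝ) ^ M)⁻¹) atTop (nhds 0) := by
    have := (tendsto_inv_atTop_nhds_zero_nat (𝕜 := ℝ)).pow M
    rw [zero_pow (by omega)] at this
    simpa using this
  have hlim : Tendsto f atTop (nhds 2) := by
    have h1 := h.trans_tendsto hu
    have h2 : Tendsto (fun n : ℕ => aeval ((n : ℝ)⁻¹) P) atTop (nhds (aeval (0 : ℝ) P)) :=
      (P.continuous_aeval.tendsto 0).comp tendsto_inv_atTop_nhds_zero_nat
    have h3 : aeval (0 : ℝ) P = 1 := by
      rw [← coeff_zero_eq_aeval_zero', hP]; simp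
    rw [h3] at h2
    simpa using h1.add (h2.const_mul 2)
  have hinv : (fun n => (2 * f n)⁻¹) =O[atTop] fun _ : ℕ => (1 : ℝ) :=
    ((hlim.const_mul 2).inv₀ (by norm_num)).isBigO_one ℝ
  have hne : ∀ᶠ n in atTop, f n ≠ 0 := hlim.eventually_ne (by norm_num)
  have h1 := h.mul (isBigO_aeval Q)
  have h2 := (isBigO_refl (fun n : ℕ => ((n : ℝ) ^ M)⁻¹) atTop).mul (isBigO_aeval (2 * R ^ M))
  simp only [mul_one] at h1 h2
  have h3 : (fun n => 2 - f n * aeval ((n : ℝ)⁻¹) Q) =O[atTop] fun n : ℕ => ((n : ℝ) ^ M)⁻¹ := by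
    refine (h2.sub h1).congr_left fun n => ?_
    have h4 := congrArg (aeval ((n : ℝ)⁻¹)) hPQ
    simp only [map_mul, map_sub, map_one, map_pow, aeval_X, inv_pow] at h4 ⊢
    simp only [map_ofNat]
    linear_combination (2 : ℝ) * h4
  have h5 := h3.mul hinv
  simp only [mul_one] at h5
  refine h5.congr' ?_ EventuallyEq.rfl
  filter_upwards [hne] with n hn
  field_simp

/-! ### Main terms, tail estimates and conclusion. -/

theorem wittenZeta_eq {G : Type} [Group G] [Finite G] (s : ℕ) :
    wittenZeta G (s : ℝ) = ∑ x : Irr G, ((x.dim : ℝ) ^ s)⁻¹ := by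
  rw [wittenZeta, finsum_eq_sum_of_fintype]
  exact Finset.sum_congr rfl fun x _ => by
    rw [Real.rpow_neg (Nat.cast_nonneg _), Real.rpow_natCast]

/-- The contribution to the zeta function of the representations of depth `b`. -/
noncomputable def depthTerm (s b n : ℕ) : ℝ :=
  ∑ L ∈ shapes b, (((∏ j, ((n : ℝ) - L j)) / hookProd L) ^ s)⁻¹

theorem hasExpansion_depthTerm {s b : ℕ} (hs : 1 ≤ s) (hb : 1 ≤ b) :
    HasExpansion (depthTerm s b) 0 := by
  have h : ∀ L ∈ shapes b, HasExpansion
      (fun n => (((∏ j, ((n : ℝ) - L j)) / hookProd L) ^ s)⁻¹) 0 := by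
    intro L _
    have h1 := ((hasExpansion_const (hookProd L)).mul
      (HasExpansion.prod univ fun j _ => hasExpansion_inv_sub (L j))).pow s
    have h2 : ((hookProd L : ℤ) * ∏ _j : Fin b, (0 : ℤ)) ^ s = 0 := by
      have : b ≠ 0 := by omega
      have : s ≠ 0 := by omega
      simp [*]
    rw [h2] at h1
    convert h1 using 2 with n
    rw [← inv_pow, inv_div, Finset.prod_inv_distrib]
    simp [div_eq_mul_inv]
  have h' := HasExpansion.sum (shapes b) h
  rw [Finset.sum_const_zero] at h'
  exact h'

theorem depthTerm_zero (s n : ℕ) : depthTerm s 0 n = 1 := by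
  have h1 : shapes 0 = {fun j => j.elim0} := by
    ext L
    rw [mem_shapes, Finset.mem_singleton]
    refine ⟨fun _ => Subsingleton.elim _ _, ?_⟩
    rintro rfl
    exact ⟨fun i => i.elim0, by simp⟩
  simp [depthTerm, h1, hookProd]

theorem hasExpansion_sum_depthTerm {s M : ℕ} (hs : 1 ≤ s) (hM : 1 ≤ M) :
    HasExpansion (fun n => ∑ b ∈ range M, depthTerm s b n) 1 := by
  have h := HasExpansion.sum (range M) (f := fun b => depthTerm s b)
    (c := fun b => if b = 0 then 1 else 0) fun b _ => by
      rcases Nat.eq_zero_or_pos b with rfl | hb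
      · rw [if_pos rfl, funext (depthTerm_zero s)]
        simpa using hasExpansion_const 1
      · rw [if_neg hb.ne']
        exact hasExpansion_depthTerm hs hb
  have h1 : (∑ b ∈ range M, if b = 0 then (1 : ℤ) else 0) = 1 := by
    rw [Finset.sum_ite_eq' (range M) 0]
    simp
    omega
  rwa [h1] at h

/-- Entries of `L` are below 2b ≤ n/2, so every factor n − L_j is at least n/2; there are at most
4^b shapes, with hook product at most b!. -/
theorem depthTerm_one_le {b n : ℕ} (hb : 4 * b ≤ n) (hn : 0 < n) :
    depthTerm 1 b n ≤ b.factorial * (8 / (n : ℝ)) ^ b := by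
  have hn' : (0 : ℝ) < n := by exact_mod_cast hn
  have h1 : ∀ L ∈ shapes b, (((∏ j, ((n : ℝ) - L j)) / hookProd L) ^ 1)⁻¹ ≤
      b.factorial * (2 / (n : ℝ)) ^ b := by
    intro L hL
    obtain ⟨hl, hsum⟩ := mem_shapes.1 hL
    have h2 : ((n : ℝ) / 2) ^ b ≤ ∏ j, ((n : ℝ) - L j) := by
      calc ((n : ℝ) / 2) ^ b = ∏ _j : Fin b, ((n : ℝ) / 2) := by rw [Finset.prod_const, Finset.card_fin]
        _ ≤ _ := by
          refine Finset.prod_le_prod (fun _ _ => by positivity) fun j _ => ?_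
          have h3 := lt_of_sum_eq hl hsum j
          have h4 : (2 * L j : ℝ) ≤ n := by exact_mod_cast (by omega : 2 * L j ≤ n)
          linarith
    have h3 : (hookProd L : ℝ) ≤ b.factorial := by exact_mod_cast hookProd_le hL
    have h4 : (0 : ℝ) < ((n : ℝ) / 2) ^ b := by positivity
    rw [pow_one, inv_div, div_le_iff₀ (h4.trans_le h2)]
    calc (hookProd L : ℝ) ≤ b.factorial := h3
      _ = b.factorial * (2 / (n : ℝ)) ^ b * ((n : ℝ) / 2) ^ b := by
        rw [mul_assoc, ← mul_pow]
        have : (2 / (n : ℝ)) * (n / 2) = 1 := by field_simp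
        rw [this, one_pow, mul_one]
      _ ≤ _ := by gcongr
  have h5 : ((shapes b).card : ℝ) ≤ 4 ^ b := by exact_mod_cast card_shapes_le b
  calc depthTerm 1 b n ≤ (shapes b).card • (b.factorial * (2 / (n : ℝ)) ^ b) :=
        Finset.sum_le_card_nsmul _ _ _ h1
    _ ≤ 4 ^ b * (b.factorial * (2 / (n : ℝ)) ^ b) := by
        rw [nsmul_eq_mul]
        gcongr
    _ = b.factorial * (8 / (n : ℝ)) ^ b := by
        rw [mul_left_comm, ← mul_pow]
        ring_nf

/-- Consecutive terms have ratio 8(b + 1)/n, at most 1/2 as long as 16(b + 1) ≤ n. -/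
theorem factorial_mul_pow_le {M N n : ℕ} (hN : 16 * N ≤ n) (hn : 0 < n) {b : ℕ} (hMb : M ≤ b)
    (hbN : b ≤ N) : (b.factorial : ℝ) * (8 / (n : ℝ)) ^ b ≤
      M.factorial * (8 / (n : ℝ)) ^ M * (1 / 2) ^ (b - M) := by
  have hn' : (0 : ℝ) < n := by exact_mod_cast hn
  induction b, hMb using Nat.le_induction with
  | base => simp
  | succ b hb ih =>
    have h1 := ih (by omega)
    have h2 : (b + 1 : ℝ) * (8 / n) ≤ 1 / 2 := by
      rw [mul_div_assoc', div_le_iff₀ hn']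
      have : (16 * (b + 1) : ℝ) ≤ n := by exact_mod_cast (by omega : 16 * (b + 1) ≤ n)
      linarith
    calc ((b + 1).factorial : ℝ) * (8 / (n : ℝ)) ^ (b + 1)
        = (b.factorial * (8 / (n : ℝ)) ^ b) * ((b + 1) * (8 / n)) := by
          rw [Nat.factorial_succ, pow_succ]; push_cast; ring
      _ ≤ (M.factorial * (8 / (n : ℝ)) ^ M * (1 / 2) ^ (b - M)) * (1 / 2) := by gcongr
      _ = _ := by
          rw [show b + 1 - M = (b - M) + 1 by omega, pow_succ]; ring

theorem sum_depthTerm_le {M N n : ℕ} (hN : 16 * N ≤ n) (hn : 0 < n) :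
    ∑ b ∈ Finset.Ico M N, depthTerm 1 b n ≤ 2 * M.factorial * 8 ^ M * ((n : ℝ) ^ M)⁻¹ := by
  calc ∑ b ∈ Finset.Ico M N, depthTerm 1 b n
      ≤ ∑ b ∈ Finset.Ico M N, M.factorial * (8 / (n : ℝ)) ^ M * (1 / 2) ^ (b - M) := by
        refine Finset.sum_le_sum fun b hb => ?_
        rw [Finset.mem_Ico] at hb
        exact (depthTerm_one_le (by omega) hn).trans (factorial_mul_pow_le hN hn hb.1 hb.2.le)
    _ = M.factorial * (8 / (n : ℝ)) ^ M * ∑ i ∈ range (N - M), (1 / 2 : ℝ) ^ i := by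
        rw [← Finset.mul_sum, Finset.sum_Ico_eq_sum_range]
        simp
    _ ≤ M.factorial * (8 / (n : ℝ)) ^ M * 2 := by
        gcongr
        exact sum_geometric_two_le _
    _ = _ := by
        rw [div_pow, div_eq_mul_inv]; ring

/-- Representations of large dimension contribute a negligible amount. -/
theorem exists_sum_large_le : ∃ q : ℝ, 0 < q ∧ q < 1 ∧ ∃ C : ℝ, ∀ (n : ℕ)
    (t : Finset (Irr (Equiv.Perm (Fin n)))), (∀ x ∈ t, 2 ^ (n / 16) ≤ x.dim ^ 2) →
      ∑ x ∈ t, (x.dim : ℝ)⁻¹ ≤ C * q ^ n := by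
  -- With q^64 = 1/2 the inverse dimension is at most q^{32⌊n/16⌋} ≤ q^{2n − 30}: one factor q^n
  -- absorbs the partition number, the other is the decay.
  obtain ⟨q, hq0, hq⟩ : ∃ q : ℝ, 0 < q ∧ q ^ 64 = 1 / 2 :=
    ⟨(1 / 2) ^ ((64 : ℕ) : ℝ)⁻¹, by positivity, Real.rpow_inv_natCast_pow (by norm_num) (by norm_num)⟩
  have hq1 : q < 1 := by
    by_contra h
    have := one_le_pow₀ (not_lt.1 h) (n := 64)
    rw [hq] at this
    norm_num at this
  refine ⟨q, hq0, hq1, Real.exp (1 / (1 - q) ^ 2) * (q ^ 30)⁻¹, fun n t ht => ?_⟩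
  have h1 : ∀ x ∈ t, (x.dim : ℝ)⁻¹ ≤ q ^ n * q ^ n * (q ^ 30)⁻¹ := by
    intro x hx
    have hd : (0 : ℝ) < x.dim := by exact_mod_cast dim_pos x
    have h2 : (2 : ℝ) ^ (n / 16) ≤ (x.dim : ℝ) ^ 2 := by exact_mod_cast ht x hx
    have h3 : (x.dim : ℝ)⁻¹ ≤ q ^ (32 * (n / 16)) := by
      refine le_of_sq_le_sq ?_ (by positivity)
      rw [← pow_mul, show 32 * (n / 16) * 2 = 64 * (n / 16) by ring, pow_mul, hq, one_div, inv_pow,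
        inv_pow]
      gcongr
    refine h3.trans ?_
    rw [← div_eq_mul_inv, le_div_iff₀ (by positivity), ← pow_add, ← pow_add]
    exact pow_le_pow_of_le_one hq0.le hq1.le (by omega)
  have h4 := card_partition_mul_pow_le hq0 hq1 n
  have h5 : (t.card : ℝ) ≤ Fintype.card (Nat.Partition n) := by
    exact_mod_cast (Finset.card_le_univ t).trans (card_irr_le n)
  calc ∑ x ∈ t, (x.dim : ℝ)⁻¹ ≤ t.card • (q ^ n * q ^ n * (q ^ 30)⁻¹) :=
        Finset.sum_le_card_nsmul _ _ _ h1
    _ ≤ Fintype.card (Nat.Partition n) * (q ^ n * q ^ n * (q ^ 30)⁻¹) := by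
        rw [nsmul_eq_mul]
        gcongr
    _ = (Fintype.card (Nat.Partition n) * q ^ n) * ((q ^ 30)⁻¹ * q ^ n) := by ring
    _ ≤ Real.exp (1 / (1 - q) ^ 2) * ((q ^ 30)⁻¹ * q ^ n) := by gcongr
    _ = _ := by ring

theorem sum_exists_isDepth {n M : ℕ} (hn : 2 * M ≤ n) {m : ℕ} (F : ℝ → ℝ)
    (t : Finset (Irr (Equiv.Perm (Fin n)))) (ht : ∀ x, x ∈ t ↔ ∃ b ∈ Finset.Ico m M, IsDepth x b) :
    ∑ x ∈ t, F x.dim =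
      ∑ b ∈ Finset.Ico m M, ∑ L ∈ shapes b, F ((∏ j, ((n : ℝ) - L j)) / hookProd L) := by
  classical
  have h : t = (Finset.Ico m M).biUnion fun b => {x | IsDepth x b} := by
    ext x
    simp [ht]
  rw [h, Finset.sum_biUnion]
  · refine Finset.sum_congr rfl fun b hb => ?_
    rw [Finset.mem_Ico] at hb
    exact sum_isDepth (by omega) _ (by simp) F
  · intro b _ c _ hbc
    rw [Function.onFun, Finset.disjoint_left]
    intro x hx hx'
    simp only [mem_filter, mem_univ, true_and] at hx hx'
    exact hbc (hx.unique hx')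

theorem sum_image_twist {n : ℕ} (F : ℝ → ℝ) (t : Finset (Irr (Equiv.Perm (Fin n))))
    [DecidableEq (Irr (Equiv.Perm (Fin n)))] :
    ∑ x ∈ t.image twist, F x.dim = ∑ x ∈ t, F x.dim := by
  rw [Finset.sum_image]
  · exact Finset.sum_congr rfl fun x _ => by rw [dim_twist]
  · intro x _ y _ h
    rw [← twist_twist x, h, twist_twist]

/-- Depths below M and their twists are disjoint and give the main term twice. Anything else has
dimension squared at least 2^{⌊n/16⌋}, or it or its twist has depth in [M, ⌊n/16⌋). The constants
`q` and `C` are passed in so as not to depend on n. -/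
theorem abs_zeta_sub_le (s M n : ℕ) (hs : 1 ≤ s) (hM : 1 ≤ M) (hn : 2 * M + 2 ≤ n)
    {q C : ℝ} (hqC : ∀ (t : Finset (Irr (Equiv.Perm (Fin n)))),
      (∀ x ∈ t, 2 ^ (n / 16) ≤ x.dim ^ 2) → ∑ x ∈ t, (x.dim : ℝ)⁻¹ ≤ C * q ^ n) :
    |wittenZeta (Equiv.Perm (Fin n)) (s : ℝ) - 2 * ∑ b ∈ range M, depthTerm s b n| ≤
      C * q ^ n + 4 * M.factorial * 8 ^ M * ((n : ℝ) ^ M)⁻¹ := by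
  classical
  let N := n / 16
  let F : ℝ → ℝ := fun d => (d ^ s)⁻¹
  let low : Finset (Irr (Equiv.Perm (Fin n))) := {x | ∃ b ∈ Finset.Ico 0 M, IsDepth x b}
  let mid : Finset (Irr (Equiv.Perm (Fin n))) := {x | ∃ b ∈ Finset.Ico M N, IsDepth x b}
  let big : Finset (Irr (Equiv.Perm (Fin n))) := {x | 2 ^ (n / 16) ≤ x.dim ^ 2}
  have hlow : ∑ x ∈ low, F x.dim = ∑ b ∈ range M, depthTerm s b n := by
    rw [sum_exists_isDepth (M := M) (m := 0) (by omega) F low (by simp [low]), Finset.range_eq_Ico]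
    rfl
  have hmid : ∑ x ∈ mid, (x.dim : ℝ)⁻¹ ≤ 2 * M.factorial * 8 ^ M * ((n : ℝ) ^ M)⁻¹ := by
    have h := sum_exists_isDepth (n := n) (M := N) (m := M) (by omega) (fun d => (d ^ 1)⁻¹) mid
      (by simp [mid])
    simp only [pow_one] at h
    rw [h]
    have := sum_depthTerm_le (M := M) (N := N) (n := n) (by omega) (by omega)
    simpa only [depthTerm, pow_one] using this
  have hdisj : Disjoint low (low.image twist) := by
    rw [Finset.disjoint_left]
    intro x hx hx'
    obtain ⟨y, hy, rfl⟩ := Finset.mem_image.1 hx'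
    simp only [low, mem_filter, mem_univ, true_and, Finset.mem_Ico] at hx hy
    obtain ⟨b, hb, hxb⟩ := hx
    obtain ⟨c, hc, hyc⟩ := hy
    exact not_hasFixed_twist hyc.1 (by omega : c + b + 2 ≤ n) hxb.1
  have hcover : (low ∪ low.image twist)ᶜ ⊆ big ∪ (mid ∪ mid.image twist) := by
    intro x hx
    rw [Finset.mem_compl, Finset.mem_union, not_or] at hx
    obtain ⟨b, hb, h⟩ := exists_hasFixed_or_twist x
    by_cases hbN : N ≤ b
    · refine Finset.mem_union_left _ ?_
      simp only [big, mem_filter, mem_univ, true_and]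
      exact (Nat.pow_le_pow_right (by norm_num) hbN).trans hb
    · refine Finset.mem_union_right _ ?_
      have key : ∀ y, HasFixed y b → y ∉ low → y ∈ mid := by
        intro y hy hyl
        obtain ⟨c, hcb, hc⟩ := exists_isDepth_le hy
        simp only [low, mid, mem_filter, mem_univ, true_and, not_exists, not_and,
          Finset.mem_Ico] at hyl ⊢
        refine ⟨c, ⟨?_, by omega⟩, hc⟩
        by_contra hcM
        exact hyl c ⟨Nat.zero_le _, by omega⟩ hc
      rcases h with h | h
      · exact Finset.mem_union_left _ (key x h hx.1)
      · refine Finset.mem_union_right _ (Finset.mem_image.2 ⟨twist x, key _ h fun hl => ?_, twist_twist x⟩)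
        exact hx.2 (Finset.mem_image.2 ⟨_, hl, twist_twist x⟩)
  have hFle : ∀ x : Irr (Equiv.Perm (Fin n)), F x.dim ≤ (x.dim : ℝ)⁻¹ := by
    intro x
    have hd : (1 : ℝ) ≤ x.dim := by exact_mod_cast dim_pos x
    exact inv_anti₀ (by linarith) (le_self_pow₀ hd (by omega))
  have hF0 : ∀ x : Irr (Equiv.Perm (Fin n)), 0 ≤ F x.dim := fun x => by positivity
  have hd0 : ∀ x : Irr (Equiv.Perm (Fin n)), 0 ≤ (x.dim : ℝ)⁻¹ := fun x => by positivity
  have hunion : ∀ a b : Finset (Irr (Equiv.Perm (Fin n))), ∑ x ∈ a ∪ b, (x.dim : ℝ)⁻¹ ≤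
      ∑ x ∈ a, (x.dim : ℝ)⁻¹ + ∑ x ∈ b, (x.dim : ℝ)⁻¹ := fun a b => by
    rw [← Finset.sum_union_inter]
    exact le_add_of_nonneg_right (Finset.sum_nonneg fun x _ => hd0 x)
  have hrest : ∑ x ∈ (low ∪ low.image twist)ᶜ, F x.dim ≤
      C * q ^ n + 4 * M.factorial * 8 ^ M * ((n : ℝ) ^ M)⁻¹ :=
    calc ∑ x ∈ (low ∪ low.image twist)ᶜ, F x.dim
        ≤ ∑ x ∈ (low ∪ low.image twist)ᶜ, (x.dim : ℝ)⁻¹ := Finset.sum_le_sum fun x _ => hFle x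
      _ ≤ ∑ x ∈ big ∪ (mid ∪ mid.image twist), (x.dim : ℝ)⁻¹ :=
          Finset.sum_le_sum_of_subset_of_nonneg hcover fun x _ _ => hd0 x
      _ ≤ ∑ x ∈ big, (x.dim : ℝ)⁻¹ +
          (∑ x ∈ mid, (x.dim : ℝ)⁻¹ + ∑ x ∈ mid.image twist, (x.dim : ℝ)⁻¹) :=
          (hunion _ _).trans (add_le_add le_rfl (hunion _ _))
      _ ≤ _ := by
          rw [sum_image_twist (fun d => d⁻¹) mid]
          have := hqC big (by simp [big])
          linarith
  have hz : wittenZeta (Equiv.Perm (Fin n)) (s : ℝ) =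
      2 * ∑ b ∈ range M, depthTerm s b n + ∑ x ∈ (low ∪ low.image twist)ᶜ, F x.dim := by
    rw [wittenZeta_eq, ← Finset.sum_add_sum_compl (low ∪ low.image twist),
      Finset.sum_union hdisj, ← hlow, two_mul]
    congr 2
    exact sum_image_twist F low
  rw [hz, add_sub_cancel_left, abs_of_nonneg (Finset.sum_nonneg fun x _ => hF0 x)]
  exact hrest

theorem isBigO_zeta_sub (s M : ℕ) (hs : 1 ≤ s) (hM : 1 ≤ M) :
    (fun n : ℕ => wittenZeta (Equiv.Perm (Fin n)) (s : ℝ) - 2 * ∑ b ∈ range M, depthTerm s b n)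
      =O[atTop] fun n : ℕ => ((n : ℝ) ^ M)⁻¹ := by
  obtain ⟨q, hq0, hq1, C, hC⟩ := exists_sum_large_le
  have h1 : (fun n : ℕ => q ^ n) =O[atTop] fun n : ℕ => ((n : ℝ) ^ M)⁻¹ := by
    have h2 := (tendsto_pow_const_mul_const_pow_of_lt_one M hq0.le hq1).isBigO_one ℝ
    have h3 := h2.mul (isBigO_refl (fun n : ℕ => ((n : ℝ) ^ M)⁻¹) atTop)
    simp only [one_mul] at h3
    refine h3.congr' ?_ EventuallyEq.rfl
    filter_upwards [eventually_ge_atTop 1] with n hn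
    have : (n : ℝ) ≠ 0 := by exact_mod_cast (by omega : n ≠ 0)
    field_simp
  have h4 := (h1.const_mul_left C).add
    ((isBigO_refl (fun n : ℕ => ((n : ℝ) ^ M)⁻¹) atTop).const_mul_left
      (4 * M.factorial * 8 ^ M))
  refine IsBigO.trans (IsBigO.of_bound 1 ?_) h4
  filter_upwards [eventually_ge_atTop (2 * M + 2)] with n hn
  rw [one_mul, Real.norm_eq_abs]
  exact (abs_zeta_sub_le s M n hs hM hn (hC n)).trans (le_abs_self _)

end SymmetricZeta

theorem mainTheorem10 (s M : ℕ) (hs : 1 ≤ s) (hM : 1 ≤ M) :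
    (∃ P : ℤ[X], P.degree < (M : WithBot ℕ) ∧ P.coeff 0 = 1 ∧
      (fun n : ℕ => wittenZeta (Equiv.Perm (Fin n)) (s : ℝ) - 2 * aeval ((n : ℝ)⁻¹) P)
        =O[atTop] fun n : ℕ => ((n : ℝ) ^ M)⁻¹) ∧
    (∃ Q : ℤ[X], Q.degree < (M : WithBot ℕ) ∧ Q.coeff 0 = 1 ∧
      (fun n : ℕ => 1 / wittenZeta (Equiv.Perm (Fin n)) (s : ℝ) - 1 / 2 * aeval ((n : ℝ)⁻¹) Q)
        =O[atTop] fun n : ℕ => ((n : ℝ) ^ M)⁻¹) := by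
  obtain ⟨P₀, hP₀, h₀⟩ := SymmetricZeta.hasExpansion_sum_depthTerm hs hM M
  obtain ⟨P, hdeg, hP, h⟩ := SymmetricZeta.exists_degree_lt hM h₀
  rw [hP₀] at hP
  have hPz : (fun n : ℕ => wittenZeta (Equiv.Perm (Fin n)) (s : ℝ) - 2 * aeval ((n : ℝ)⁻¹) P)
        =O[atTop] fun n : ℕ => ((n : ℝ) ^ M)⁻¹ :=
    ((SymmetricZeta.isBigO_zeta_sub s M hs hM).add (h.const_mul_left 2)).congr_left fun n => by ring
  refine ⟨⟨P, hdeg, hP, hPz⟩, ?_⟩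
  obtain ⟨Q₀, hQ₀, hz⟩ := SymmetricZeta.exists_inv_expansion hM hP hPz
  -- Doubling clears the factor 1/2, so that truncation applies to an integral polynomial.
  have hz2 : (fun n : ℕ => 2 * (1 / wittenZeta (Equiv.Perm (Fin n)) (s : ℝ)) -
      aeval ((n : ℝ)⁻¹) Q₀) =O[atTop] fun n : ℕ => ((n : ℝ) ^ M)⁻¹ :=
    (hz.const_mul_left 2).congr_left fun n => by ring
  obtain ⟨Q, hQdeg, hQ, hzQ⟩ := SymmetricZeta.exists_degree_lt hM hz2
  exact ⟨Q, hQdeg, hQ.trans hQ₀, (hzQ.const_mul_left (1 / 2)).congr_left fun n => by ring⟩
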